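/- Let $G$ be a finite connected metric graph (loops and multiple edges allowed, every edge $e$ has a length $l(e)>0$) in which every vertex has degree at least $3$. A closed geodesic in $G$ is a closed path $e_0,\dots,e_{n-1}$ ($n\ge 1$) of consecutive oriented edges with $e_{i+1}\ne\overline{e_i}$ for $0\le i<n-1$ and $e_{n-1}\neq\overline{e_0}$; its length is the sum of the lengths of its edges. Assume that the set of lengths of closed geodesics in $G$ is not contained in a discrete subgroup of $\mathbb R$. Let $\mathcal T$ be the universal covering tree of $G$ with the lifted path metric $d_{\mathcal T}$, and let $F$ be the fundamental group of $G$, acting on $\mathcal T$ by deck transformations. For a vertex $o$ of $\mathcal T$ let $B(o,T)=\{y\in\mathcal T: d_{\mathcal T}(o,y)<T\}$, let $\mathrm{vol}(B(o,T))$ be the total edge length inside it, and let $$h=\lim_{T\to\infty}\frac1T\log \mathrm{vol}(B(o,T))$$ be the volume entropy of $\mathcal T$; this limit exists, is positive and does not depend on $o$. Fix a vertex $o$ of $\mathcal T$, put $L(x)=d_{\mathcal T}(o,ox)$ for $x\in F$, and let $\mathfrak C$ be a non-trivial conjugacy class in $F$. Then the series $$\eta_{\mathfrak C}(s)=\sum_{x\in\mathfrak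 C}e^{-sL(x)}$$ converges absolutely and is analytic for $\mathrm{Re}(s)>h/2$. Moreover there are an open set $U\supseteq\{s\in\mathbb C:\mathrm{Re}(s)\ge h/2\}$ and an analytic function on $U\setminus\{h/2\}$ that agrees with $\eta_{\mathfrak C}$ for $\mathrm{Re}(s)>h/2$ and has a simple pole with positive residue at $s=h/2$. -/

import Mathlib

open Filter Topology MeasureTheory

/-- A metric graph with vertex type `V` and edge type `E`; loops and multiple edges are allowed.
Each edge carries an arbitrary reference orientation, from `src e` to `tgt e`, and a positive
length. -/
structure MetricGraph (V E : Type*) where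
  src : E → V
  tgt : E → V
  length : E → ℝ
  length_pos : ∀ e, 0 < length e

namespace MetricGraph

/-- The oriented edge set of the graph is `E × Bool`: `(e, true)` is the edge `e` with its reference
orientation and `(e, false)` is `e` with the opposite orientation. This is the initial vertex. -/
def initial {V E : Type*} (G : MetricGraph V E) (a : E × Bool) : V :=
  if a.2 then G.src a.1 else G.tgt a.1

/-- The terminal vertex of an oriented edge. -/
def terminal {V E : Type*} (G : MetricGraph V E) (a : E × Bool) : V :=
  if a.2 then G.tgt a.1 else G.src a.1

/-- The oriented edge with its orientation reversed. -/
def rev {E : Type*} (a : E × Bool) : E × Bool := (a.1, !a.2)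

/-- `G.IsPath u w v`: the list `w` of oriented edges is a path from `u` to `v`, that is, the edges
are consecutive. Backtracking is allowed. -/
def IsPath {V E : Type*} (G : MetricGraph V E) : V → List (E × Bool) → V → Prop
  | u, [], v => u = v
  | u, a :: w, v => G.initial a = u ∧ IsPath G (G.terminal a) w v

/-- The length of a path: the sum of the lengths of its edges. -/
def pathLength {V E : Type*} (G : MetricGraph V E) (w : List (E × Bool)) : ℝ :=
  (w.map fun a => G.length a.1).sum

/-- Any two vertices are joined by a path. -/
def Connected {V E : Type*} (G : MetricGraph V E) : Prop :=
  ∀ u v, ∃ w, G.IsPath u w v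

/-- The degree of a vertex: the number of oriented edges starting there (so a loop counts twice). -/
noncomputable def degree {V E : Type*} (G : MetricGraph V E) (v : V) : ℕ :=
  Nat.card {a : E × Bool // G.initial a = v}

/-- A closed geodesic: a closed path `e₀, …, eₙ₋₁` with `n ≥ 1` which is non-backtracking and
satisfies `eₙ₋₁ ≠ rev e₀`. -/
def IsClosedGeodesic {V E : Type*} (G : MetricGraph V E) (w : List (E × Bool)) : Prop :=
  (∃ v, G.IsPath v w v) ∧ w.IsChain (fun a b => b ≠ rev a) ∧
    ∃ h : w ≠ [], w.getLast h ≠ rev (w.head h)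

/-- The set of lengths of closed geodesics. -/
def closedGeodesicLengths {V E : Type*} (G : MetricGraph V E) : Set ℝ :=
  {x | ∃ w, G.IsClosedGeodesic w ∧ G.pathLength w = x}

/-- The path metric on vertices. -/
noncomputable def vertexDist {V E : Type*} (G : MetricGraph V E) (u v : V) : ℝ :=
  sInf {x | ∃ w, G.IsPath u w v ∧ G.pathLength w = x}

/-- The distance from the vertex `o` to the point of the edge `e` (an isometric copy of the interval
`[0, length e]`) that lies at distance `t` along `e` from `src e`. -/
noncomputable def pointDist {V E : Type*} (G : MetricGraph V E) (o : V) (e : E) (t : ℝ) : ℝ :=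
  min (G.vertexDist o (G.src e) + t) (G.vertexDist o (G.tgt e) + (G.length e - t))

/-- The volume of the open ball `B(o, T)`: the total length of the parts of edges inside it. -/
noncomputable def ballVolume {V E : Type*} (G : MetricGraph V E) (o : V) (T : ℝ) : ℝ :=
  (∑' e : E, volume {t : ℝ | t ∈ Set.Icc 0 (G.length e) ∧ G.pointDist o e t < T}).toReal

theorem isPath_append {V E : Type*} (G : MetricGraph V E) {u v x : V} {w z : List (E × Bool)}
    (hw : G.IsPath u w v) (hz : G.IsPath v z x) : G.IsPath u (w ++ z) x := by
  induction w generalizing u with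
  | nil => cases hw; exact hz
  | cons a w ih => exact ⟨hw.1, ih hw.2⟩

theorem isPath_invRev {V E : Type*} (G : MetricGraph V E) {u v : V} {w : List (E × Bool)}
    (hw : G.IsPath u w v) : G.IsPath v (FreeGroup.invRev w) u := by
  induction w generalizing u with
  | nil => cases hw; rfl
  | cons a w ih =>
    have h : FreeGroup.invRev (a :: w) = FreeGroup.invRev w ++ [rev a] := by
      simp [FreeGroup.invRev, rev]
    rw [h]
    refine G.isPath_append (ih hw.2) ⟨?_, ?_⟩
    · cases a with | mk e b => cases b <;> rfl
    · rw [← hw.1]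
      cases a with | mk e b => cases b <;> rfl

/-- The fundamental group of `G` at `v₀`: homotopy classes of closed paths at `v₀`. Two paths with
the same endpoints are homotopic if and only if they become equal after cancellation of all
backtracking, i.e. if they represent the same element of the free group on `E`, in which
`(e, true)` is the generator `e` and `(e, false)` is its inverse. Concatenation of paths is
multiplication in that free group. -/
def fundamentalGroup {V E : Type*} (G : MetricGraph V E) (v₀ : V) : Subgroup (FreeGroup E) where
  carrier := {g | ∃ w, G.IsPath v₀ w v₀ ∧ FreeGroup.mk w = g}
  mul_mem' := by
    rintro _ _ ⟨w, hw, rfl⟩ ⟨z, hz, rfl⟩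
    exact ⟨w ++ z, G.isPath_append hw hz, by rw [FreeGroup.mul_mk]⟩
  one_mem' := ⟨[], rfl, rfl⟩
  inv_mem' := by
    rintro _ ⟨w, hw, rfl⟩
    exact ⟨FreeGroup.invRev w, G.isPath_invRev hw, by rw [FreeGroup.inv_mk]⟩

/-- The vertices of the universal cover: homotopy classes, with fixed endpoints, of paths in `G`
starting at `v₀`, recorded as the pair of the terminal vertex and the class in the free group. -/
def CoverVertex {V E : Type*} (G : MetricGraph V E) (v₀ : V) : Type _ :=
  {p : V × FreeGroup E // ∃ w, G.IsPath v₀ w p.1 ∧ FreeGroup.mk w = p.2}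

/-- The edges of the universal cover: a vertex over `v` and an edge of `G` with source `v`. -/
def CoverEdge {V E : Type*} (G : MetricGraph V E) (v₀ : V) : Type _ :=
  {q : CoverVertex G v₀ × E // q.1.1.1 = G.src q.2}

/-- The universal covering tree of `G`, with edge lengths lifted from `G`: the edge over `e` that
starts at the class of the path `w` ends at the class of `w` followed by `e`. -/
def universalCover {V E : Type*} (G : MetricGraph V E) (v₀ : V) :
    MetricGraph (CoverVertex G v₀) (CoverEdge G v₀) where
  src q := q.1.1
  tgt q := ⟨(G.tgt q.1.2, q.1.1.1.2 * FreeGroup.of q.1.2), by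
    obtain ⟨⟨⟨⟨v, g⟩, w, hw, hg⟩, e⟩, he⟩ := q
    refine ⟨w ++ [(e, true)], G.isPath_append hw ⟨he.symm, rfl⟩, ?_⟩
    simp only at hg ⊢
    rw [← FreeGroup.mul_mk, hg]
    rfl⟩
  length q := G.length q.1.2
  length_pos q := G.length_pos q.1.2

/-- The action of the fundamental group on the universal cover by deck transformations:
a closed path at `v₀` is put in front of a path that starts at `v₀`. -/
instance deckAction {V E : Type*} (G : MetricGraph V E) (v₀ : V) :
    MulAction (G.fundamentalGroup v₀) (CoverVertex G v₀) where
  smul x p := ⟨(p.1.1, (x : FreeGroup E) * p.1.2), by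
    obtain ⟨g, z, hz, hg⟩ := x
    obtain ⟨p, w, hw, hp⟩ := p
    exact ⟨z ++ w, G.isPath_append hz hw,
      FreeGroup.mul_mk.symm.trans (congrArg₂ (· * ·) hg hp)⟩⟩
  one_smul p := Subtype.ext (Prod.ext rfl (one_mul _))
  mul_smul x y p := Subtype.ext (Prod.ext rfl (mul_assoc _ _ _))

/-- The displacement `L(x) = d(o, x o)` of the vertex `o` of the universal cover. -/
noncomputable def displacement {V E : Type*} (G : MetricGraph V E) (v₀ : V)
    (o : CoverVertex G v₀) (x : G.fundamentalGroup v₀) : ℝ :=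
  (G.universalCover v₀).vertexDist o (x • o)

/-- The generating function `η(s) = ∑ exp (-s L(x))`, the sum being over the conjugacy class `C`. -/
noncomputable def conjGenFun {V E : Type*} (G : MetricGraph V E) (v₀ : V)
    (o : CoverVertex G v₀) (C : ConjClasses (G.fundamentalGroup v₀)) (s : ℂ) : ℂ :=
  ∑' x : C.carrier, Complex.exp (-s * (G.displacement v₀ o x : ℂ))

end MetricGraph

/-- `f` has a simple pole at `z` with residue `c`. -/
def HasSimplePoleAt (f : ℂ → ℂ) (z c : ℂ) : Prop :=
  c ≠ 0 ∧ ∃ g : ℂ → ℂ, AnalyticAt ℂ g z ∧ ∀ᶠ s in 𝓝[≠] z, f s = c / (s - z) + g s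

/-! On the finite set of oriented edges consider the operators (L_σ v)(a) = e^{-σ l(a)} Σ v(b),
summed over the b that may follow a without backtracking. Minimal degree 3 makes this relation
irreducible (`reflTransGen_follows`) and gives every edge two successors, so Perron's theorem
(`exists_perron`) yields h > 0 and a positive v with L_h v = v. Vertices of the universal cover are
reduced paths from o. Counting them by length leads to a renewal recursion whose homogeneous part is
solved by v(a)e^{hT}, so ball volumes lie between multiples of e^{hT} and h is the volume entropy
(`tendsto_log_ballVolume`).

Seen from o, an element of the conjugacy class is uniquely a reduced word w c w⁻¹ with c cyclically
reduced, and its displacement is |c| + 2|w|. Only finitely many cores c occur (`conjCores_finite`).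
A nonempty w is admissible exactly when it is a non-backtracking path from o whose last edge
satisfies a condition depending on c (`cons_mem_conjPairs_iff`). Hence η(s) is a finite sum of terms
e^{-s|c|} times a constant plus path series evaluated at 2s; the factor 2 is what turns h into h/2.

The path series solve a linear system with matrix 1 - M(s), so by Cramer's rule they are quotients
of entire functions with denominator det(1 - M(s)). For Re s > h there is no nonzero fixed vector of
M(s). For Re s = h and t = Im s ≠ 0, the absolute values of a fixed vector form a multiple of v;
equality in the triangle inequality then forces its phases to advance by e^{it l(a)} along each
edge, and every closed geodesic would have length in (2π/t)ℤ (`transferDet_ne_zero`, `no_phase`).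

At h itself no multiplicity of the zero of the determinant is computed. Positivity shows that on the
real axis the series lie between positive multiples of 1/(σ - h) (`exists_pathSeries_bounds`). A
meromorphic function with such bounds has a simple pole with positive residue
(`hasSimplePoleAt_of_bounds`), and the bounds add up over the cores, so poles cannot cancel. -/

namespace TransferOperator

/-! ### Perron theory of the real transfer operator -/

open Classical in
/-- The weighted transfer operator of a relation `N` with roof function `l`. -/
noncomputable def transfer {A : Type*} [Fintype A] (N : A → A → Prop) (l : A → ℝ) (σ : ℝ)
    (v : A → ℝ) (a : A) : ℝ :=
  Real.exp (-σ * l a) * ∑ b with N a b, v b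

section

variable {A : Type*} [Fintype A] {N : A → A → Prop} {l : A → ℝ}

theorem transfer_mono (σ : ℝ) {v w : A → ℝ} (h : ∀ a, v a ≤ w a) (a : A) :
    transfer N l σ v a ≤ transfer N l σ w a :=
  mul_le_mul_of_nonneg_left (Finset.sum_le_sum fun b _ => h b) (Real.exp_pos _).le

theorem transfer_nonneg (σ : ℝ) {v : A → ℝ} (h : ∀ a, 0 ≤ v a) (a : A) :
    0 ≤ transfer N l σ v a :=
  mul_nonneg (Real.exp_pos _).le (Finset.sum_nonneg fun b _ => h b)

theorem transfer_smul (σ c : ℝ) (v : A → ℝ) (a : A) :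
    transfer N l σ (fun b => c * v b) a = c * transfer N l σ v a := by
  simp only [transfer, ← Finset.mul_sum]; ring

theorem transfer_add (σ : ℝ) (v w : A → ℝ) (a : A) :
    transfer N l σ (fun b => v b + w b) a = transfer N l σ v a + transfer N l σ w a := by
  simp only [transfer, Finset.sum_add_distrib]; ring

theorem transfer_exp (h σ : ℝ) (v : A → ℝ) (a : A) :
    transfer N l σ v a = Real.exp (-(σ - h) * l a) * transfer N l h v a := by
  simp only [transfer, ← mul_assoc, ← Real.exp_add]; ring_nf

theorem le_transfer (σ : ℝ) {v : A → ℝ} (h : ∀ a, 0 ≤ v a) {a b : A} (hab : N a b) :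
    Real.exp (-σ * l a) * v b ≤ transfer N l σ v a := by
  classical
  refine mul_le_mul_of_nonneg_left ?_ (Real.exp_pos _).le
  exact Finset.single_le_sum (f := v) (fun b _ => h b) (by simpa using hab)

theorem continuous_transfer (a : A) :
    Continuous fun p : ℝ × (A → ℝ) => transfer N l p.1 p.2 a := by
  unfold transfer; fun_prop

/-- A nonnegative function dominating its transfer is bounded below along paths,
uniformly in `σ ≤ B`. -/
theorem exists_harnack (hl : ∀ a, 0 < l a) (B : ℝ) {a b : A}
    (hab : Relation.ReflTransGen N a b) :
    ∃ κ > 0, ∀ σ ≤ B, ∀ u : A → ℝ, (∀ c, 0 ≤ u c) → (∀ c, transfer N l σ u c ≤ u c) →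
      κ * u b ≤ u a := by
  induction hab using Relation.ReflTransGen.head_induction_on with
  | refl => exact ⟨1, one_pos, fun σ _ u _ _ => by simp⟩
  | @head a c hac _ ih =>
    obtain ⟨κ, hκ, H⟩ := ih
    refine ⟨Real.exp (-B * l a) * κ, by positivity, fun σ hσ u hu hT => ?_⟩
    have h1 := H σ hσ u hu hT
    have h2 := le_transfer (l := l) σ hu hac
    have h3 : Real.exp (-B * l a) ≤ Real.exp (-σ * l a) := by
      apply Real.exp_le_exp.2; nlinarith [hl a]
    calc Real.exp (-B * l a) * κ * u b = Real.exp (-B * l a) * (κ * u b) := by ring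
      _ ≤ Real.exp (-σ * l a) * u c := by
        apply mul_le_mul h3 h1 (mul_nonneg hκ.le (hu b)) (Real.exp_pos _).le
      _ ≤ u a := h2.trans (hT a)

theorem pos_of_transfer_le (hl : ∀ a, 0 < l a) (hirr : ∀ a b, Relation.ReflTransGen N a b) {σ : ℝ}
    {u : A → ℝ} (hu : ∀ a, 0 ≤ u a) (hT : ∀ a, transfer N l σ u a ≤ u a) {b : A} (hb : 0 < u b)
    (a : A) : 0 < u a := by
  obtain ⟨κ, hκ, H⟩ := exists_harnack hl σ (hirr a b)
  have := H σ le_rfl u hu hT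
  have h2 : 0 < κ * u b := by positivity
  linarith

/-- One step of the lazy transfer operator. -/
noncomputable def lazyTransfer (N : A → A → Prop) (l : A → ℝ) (σ : ℝ) (v : A → ℝ) (a : A) : ℝ :=
  v a + transfer N l σ v a

theorem lazyTransfer_iterate_nonneg (σ : ℝ) {v : A → ℝ} (h : ∀ a, 0 ≤ v a) (n : ℕ) (a : A) :
    0 ≤ (lazyTransfer N l σ)^[n] v a := by
  induction n generalizing a with
  | zero => exact h a
  | succ n ih =>
    rw [Function.iterate_succ_apply']
    exact add_nonneg (ih a) (transfer_nonneg _ ih a)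

/-- The identity summand keeps positive coordinates positive, so irreducibility suffices and no
aperiodicity is needed. -/
theorem exists_lazyTransfer_iterate_pos (hirr : ∀ a b, Relation.ReflTransGen N a b) (σ : ℝ)
    {y : A → ℝ} (hy : ∀ a, 0 ≤ y a) {b : A} (hb : 0 < y b) :
    ∃ n, ∀ a, 0 < (lazyTransfer N l σ)^[n] y a := by
  have key : ∀ a, ∀ᶠ n in atTop, 0 < (lazyTransfer N l σ)^[n] y a := by
    intro a
    have mono : ∀ a n, 0 < (lazyTransfer N l σ)^[n] y a →
        0 < (lazyTransfer N l σ)^[n + 1] y a := by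
      intro a n h
      rw [Function.iterate_succ_apply']
      exact add_pos_of_pos_of_nonneg h
        (transfer_nonneg _ (lazyTransfer_iterate_nonneg σ hy n) a)
    have ex : ∃ n, 0 < (lazyTransfer N l σ)^[n] y a := by
      have hab := hirr a b
      induction hab using Relation.ReflTransGen.head_induction_on with
      | refl => exact ⟨0, hb⟩
      | @head a c hac _ ih =>
        obtain ⟨n, hn⟩ := ih
        refine ⟨n + 1, ?_⟩
        rw [Function.iterate_succ_apply']
        refine add_pos_of_nonneg_of_pos (lazyTransfer_iterate_nonneg σ hy n a) ?_
        refine lt_of_lt_of_le ?_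
          (le_transfer (l := l) σ (lazyTransfer_iterate_nonneg σ hy n) hac)
        exact mul_pos (Real.exp_pos _) hn
    obtain ⟨n, hn⟩ := ex
    filter_upwards [eventually_ge_atTop n] with m hm
    induction m, hm using Nat.le_induction with
    | base => exact hn
    | succ m _ ih => exact mono a m ih
  exact (eventually_all.2 key).exists

/-- L commutes with 1 + L, so the defect Lv - v is carried along by the same iterates as v. -/
theorem transfer_lazyTransfer_iterate_sub (σ : ℝ) (v : A → ℝ) (n : ℕ) (a : A) :
    transfer N l σ ((lazyTransfer N l σ)^[n] v) a - (lazyTransfer N l σ)^[n] v a =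
      (lazyTransfer N l σ)^[n] (fun c => transfer N l σ v c - v c) a := by
  induction n generalizing a with
  | zero => rfl
  | succ n ih =>
    rw [Function.iterate_succ_apply', Function.iterate_succ_apply']
    have e : (lazyTransfer N l σ)^[n] (fun c => transfer N l σ v c - v c) =
        fun a => transfer N l σ ((lazyTransfer N l σ)^[n] v) a +
          (-1) * (lazyTransfer N l σ)^[n] v a := by
      funext a; rw [← ih]; ring
    rw [e]
    unfold lazyTransfer
    simp only [transfer_add, transfer_smul]
    ring

theorem exists_le_transfer_of_strict (σ : ℝ) {w : A → ℝ} (h : ∀ a, w a < transfer N l σ w a) :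
    ∃ ε > 0, ∀ a, w a ≤ transfer N l (σ + ε) w a := by
  have key : ∀ a, ∀ᶠ ε in 𝓝 (0 : ℝ), w a < transfer N l (σ + ε) w a := by
    intro a
    have hc : Continuous fun ε : ℝ => transfer N l (σ + ε) w a := by unfold transfer; fun_prop
    refine (hc.tendsto 0).eventually_const_lt ?_
    simpa using h a
  have h2 : ∀ᶠ ε in 𝓝[>] (0 : ℝ), ∀ a, w a < transfer N l (σ + ε) w a :=
    nhdsWithin_le_nhds (eventually_all.2 key)
  obtain ⟨ε, h3, h4⟩ := (h2.and self_mem_nhdsWithin).exists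
  exact ⟨ε, h4, fun a => (h3 a).le⟩

/-- Perron's theorem: there is a positive exponent `h` for which the transfer operator has a
positive fixed function. -/
theorem exists_perron [Nonempty A] (hl : ∀ a, 0 < l a)
    (hirr : ∀ a b, Relation.ReflTransGen N a b)
    (hdeg : ∀ a, ∃ b c, b ≠ c ∧ N a b ∧ N a c) :
    ∃ h > 0, ∃ v : A → ℝ, (∀ a, 0 < v a) ∧ ∀ a, transfer N l h v a = v a := by
  classical
  obtain ⟨a₀, ha₀⟩ := Finite.exists_min l
  -- At a maximal coordinate, x ≤ L_σ x gives x(a) ≤ e^{-σ l(a)} |A| x(a); this bounds σ.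
  set B : ℝ := Real.log (Fintype.card A) / l a₀ with hB
  have hbound : ∀ σ, 0 ≤ σ → ∀ x ∈ stdSimplex ℝ A, (∀ a, x a ≤ transfer N l σ x a) → σ ≤ B := by
    intro σ hσ x hx hT
    obtain ⟨a, ha⟩ := Finite.exists_max x
    have hxa : 0 < x a := by
      by_contra hneg
      have : ∑ b, x b ≤ 0 := Finset.sum_nonpos fun b _ => (ha b).trans (not_lt.1 hneg)
      linarith [hx.2]
    have h1 : x a ≤ Real.exp (-σ * l a) * (Fintype.card A * x a) := by
      refine (hT a).trans (mul_le_mul_of_nonneg_left ?_ (Real.exp_pos _).le)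
      calc ∑ b with N a b, x b ≤ ∑ b, x b :=
            Finset.sum_le_sum_of_subset_of_nonneg (Finset.filter_subset _ _) fun b _ _ => hx.1 b
        _ ≤ ∑ _b : A, x a := Finset.sum_le_sum fun b _ => ha b
        _ = _ := by simp
    have h2 : Real.exp (σ * l a) ≤ Fintype.card A := by
      have h3 : x a * Real.exp (σ * l a) ≤ x a * Fintype.card A := by
        calc x a * Real.exp (σ * l a)
            ≤ Real.exp (-σ * l a) * (Fintype.card A * x a) * Real.exp (σ * l a) :=
              mul_le_mul_of_nonneg_right h1 (Real.exp_pos _).le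
          _ = x a * Fintype.card A * (Real.exp (-σ * l a) * Real.exp (σ * l a)) := by ring
          _ = x a * Fintype.card A := by rw [← Real.exp_add]; simp
      exact le_of_mul_le_mul_left h3 hxa
    rw [hB, le_div_iff₀ (hl a₀)]
    calc σ * l a₀ ≤ σ * l a := mul_le_mul_of_nonneg_left (ha₀ a) hσ
      _ ≤ _ := (Real.le_log_iff_exp_le (by exact_mod_cast Fintype.card_pos)).2 h2
  -- The exponent h is the largest σ for which some probability vector satisfies x ≤ L_σ x;
  -- compactness of this set makes the maximum attained.
  let K : Set (ℝ × (A → ℝ)) :=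
    (Set.Icc 0 B ×ˢ stdSimplex ℝ A) ∩ {p | ∀ a, p.2 a ≤ transfer N l p.1 p.2 a}
  have hK : IsCompact K := by
    refine (isCompact_Icc.prod (isCompact_stdSimplex ℝ A)).inter_right ?_
    rw [Set.ofPred_forall]
    refine isClosed_iInter fun a => isClosed_le ?_ (continuous_transfer a)
    exact (continuous_apply a).comp continuous_snd
  have mem : ∀ σ, 0 ≤ σ → ∀ w : A → ℝ, (∀ a, 0 < w a) → (∀ a, w a ≤ transfer N l σ w a) →
      ∃ p ∈ K, p.1 = σ := by
    intro σ hσ w hw hT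
    have hs : 0 < ∑ a, w a := Finset.sum_pos (fun a _ => hw a) Finset.univ_nonempty
    have hx : (fun a => (∑ a, w a)⁻¹ * w a) ∈ stdSimplex ℝ A := by
      refine ⟨fun a => by have := hw a; positivity, ?_⟩
      rw [← Finset.mul_sum]; exact inv_mul_cancel₀ hs.ne'
    have hx2 : ∀ a, (∑ a, w a)⁻¹ * w a ≤
        transfer N l σ (fun a => (∑ a, w a)⁻¹ * w a) a := by
      intro a
      rw [transfer_smul]
      exact mul_le_mul_of_nonneg_left (hT a) (by positivity)
    exact ⟨(σ, fun a => (∑ a, w a)⁻¹ * w a), ⟨⟨⟨hσ, hbound σ hσ _ hx hx2⟩, hx⟩, hx2⟩, rfl⟩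
  -- At σ = 0 the constant 1 is strictly below its transfer, since every element has two successors;
  -- strictness leaves room for a positive σ.
  have start : ∃ ε > 0, ∃ p ∈ K, p.1 = ε := by
    obtain ⟨ε, hε, h⟩ := exists_le_transfer_of_strict (N := N) (l := l) 0 (w := fun _ => (1 : ℝ)) (by
      intro a
      obtain ⟨b, c, hbc, hb, hc⟩ := hdeg a
      simp only [transfer, neg_zero, zero_mul, Real.exp_zero, one_mul, Finset.sum_const,
        nsmul_eq_mul, mul_one]
      have : 1 < (Finset.univ.filter fun b => N a b).card :=
        Finset.one_lt_card.2 ⟨b, by simpa using hb, c, by simpa using hc, hbc⟩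
      exact_mod_cast this)
    rw [zero_add] at h
    exact ⟨ε, hε, mem ε hε.le _ (fun _ => one_pos) h⟩
  obtain ⟨ε, hε, p₀, hp₀, hpε⟩ := start
  obtain ⟨p, hp, hmax⟩ := hK.exists_isMaxOn ⟨p₀, hp₀⟩ continuous_fst.continuousOn
  obtain ⟨h, v⟩ := p
  have hh : 0 < h := by
    have : p₀.1 ≤ h := hmax hp₀
    linarith
  have hv0 : ∀ a, 0 ≤ v a := hp.1.2.1
  have hv1 : ∑ a, v a = 1 := hp.1.2.2
  have hvT : ∀ a, v a ≤ transfer N l h v a := hp.2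
  -- A defect at one coordinate is spread to all coordinates by the lazy iterates; a strict
  -- inequality everywhere would survive a larger exponent, against maximality.
  have heq : ∀ a, transfer N l h v a = v a := by
    by_contra hne
    push Not at hne
    obtain ⟨a, ha⟩ := hne
    have hlt : 0 < transfer N l h v a - v a := sub_pos.2 (lt_of_le_of_ne (hvT a) ha.symm)
    obtain ⟨b, hb⟩ : ∃ b, 0 < v b := by
      by_contra! hcon
      have := Finset.sum_nonpos (s := Finset.univ) fun b _ => hcon b
      linarith
    obtain ⟨m, hm⟩ := exists_lazyTransfer_iterate_pos (l := l) hirr h hv0 hb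
    -- After m steps the function is positive everywhere while the defect at `a` is still positive;
    -- n' more steps make the defect positive everywhere too.
    obtain ⟨n', hn'⟩ := exists_lazyTransfer_iterate_pos (l := l) hirr h
      (y := (lazyTransfer N l h)^[m] (fun c => transfer N l h v c - v c))
      (b := a) (lazyTransfer_iterate_nonneg h (fun c => sub_nonneg.2 (hvT c)) m) (by
        clear hm
        induction m with
        | zero => exact hlt
        | succ m ih =>
          rw [Function.iterate_succ_apply']
          exact add_pos_of_pos_of_nonneg ih (transfer_nonneg _
            (lazyTransfer_iterate_nonneg h (fun c => sub_nonneg.2 (hvT c)) m) a))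
    have hw : ∀ a, 0 < (lazyTransfer N l h)^[n' + m] v a := by
      intro a
      clear hn'
      rw [Function.iterate_add_apply]
      induction n' generalizing a with
      | zero => exact hm a
      | succ k ih =>
        rw [Function.iterate_succ_apply']
        exact add_pos_of_pos_of_nonneg (ih a) (transfer_nonneg _ (fun b => (ih b).le) a)
    obtain ⟨δ, hδ, hδw⟩ := exists_le_transfer_of_strict (N := N) (l := l) h
      (w := (lazyTransfer N l h)^[n' + m] v) (by
        intro a
        rw [← sub_pos, transfer_lazyTransfer_iterate_sub, Function.iterate_add_apply]
        exact hn' a)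
    obtain ⟨p', hp', hpe⟩ := mem (h + δ) (by linarith) _ hw hδw
    have : p'.1 ≤ h := hmax hp'
    linarith
  obtain ⟨b, hb⟩ : ∃ b, 0 < v b := by
    by_contra! hcon
    have := Finset.sum_nonpos (s := Finset.univ) fun b _ => hcon b
    linarith
  exact ⟨h, hh, v, pos_of_transfer_le hl hirr hv0 (fun a => (heq a).le) hb, heq⟩

/-- A nonnegative subinvariant function is a multiple of the Perron function. -/
theorem eq_smul_of_le_transfer [Nonempty A]
    (hirr : ∀ a b, Relation.ReflTransGen N a b) {h : ℝ} {v : A → ℝ} (hv : ∀ a, 0 < v a)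
    (hT : ∀ a, transfer N l h v a = v a) {x : A → ℝ} (hx : ∀ a, x a ≤ transfer N l h x a) :
    ∃ t, ∀ a, x a = t * v a := by
  classical
  obtain ⟨a₀, ha₀⟩ := Finite.exists_max fun a => x a / v a
  refine ⟨x a₀ / v a₀, fun a => ?_⟩
  have hle : ∀ a, x a ≤ x a₀ / v a₀ * v a := fun a => (div_le_iff₀ (hv a)).1 (ha₀ a)
  have hab := hirr a₀ a
  induction hab with
  | refl => field_simp [(hv a₀).ne']
  | @tail a b _ hab ih =>
    -- The ratio x/v is maximal at `a`; a smaller ratio at the successor `b` would make (L_h x)(a) <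
    -- x(a).
    by_contra hne
    have hlt : x b < x a₀ / v a₀ * v b := lt_of_le_of_ne (hle b) hne
    have : transfer N l h x a < transfer N l h (fun c => x a₀ / v a₀ * v c) a := by
      refine mul_lt_mul_of_pos_left ?_ (Real.exp_pos _)
      exact Finset.sum_lt_sum (fun c _ => hle c) ⟨b, by simpa using hab, hlt⟩
    rw [transfer_smul, hT, ← ih] at this
    exact absurd (hx a) (not_le.2 this)

/-- Beyond the Perron exponent there is no nonzero nonnegative subinvariant function. -/
theorem eq_zero_of_le_transfer [Nonempty A] (hl : ∀ a, 0 < l a) {h : ℝ} {v : A → ℝ}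
    (hv : ∀ a, 0 < v a) (hT : ∀ a, transfer N l h v a = v a) {σ : ℝ} (hσ : h < σ) {x : A → ℝ}
    (hx0 : ∀ a, 0 ≤ x a) (hx : ∀ a, x a ≤ transfer N l σ x a) (a : A) : x a = 0 := by
  obtain ⟨a₀, ha₀⟩ := Finite.exists_max fun a => x a / v a
  have hle : ∀ a, x a ≤ x a₀ / v a₀ * v a := fun a => (div_le_iff₀ (hv a)).1 (ha₀ a)
  have h1 : x a₀ ≤ Real.exp (-(σ - h) * l a₀) * x a₀ := by
    calc x a₀ ≤ _ := hx a₀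
      _ ≤ transfer N l σ (fun c => x a₀ / v a₀ * v c) a₀ := transfer_mono σ hle a₀
      _ = _ := by
        rw [transfer_exp h, transfer_smul, hT, div_mul_cancel₀ _ (hv a₀).ne']
  have h2 : Real.exp (-(σ - h) * l a₀) < 1 := by
    rw [Real.exp_lt_one_iff]; nlinarith [hl a₀]
  have h3 : x a₀ = 0 := by
    have := hx0 a₀
    nlinarith
  have := hle a
  rw [h3] at this
  simp at this
  exact le_antisymm this (hx0 a)

end

end TransferOperator

/-! ### Complex path series, convergence, and the determinant -/

namespace TransferOperator

section

variable {A : Type*} {N : A → A → Prop} {l : A → ℝ} {Q : A → Prop}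

open Classical in
/-- The weight `exp (-s * length)` of the path `a :: w` if it is an `N`-chain whose last element
satisfies `Q`, and `0` otherwise. -/
noncomputable def pathWeight (N : A → A → Prop) (l : A → ℝ) (Q : A → Prop) (s : ℂ) :
    A → List A → ℂ
  | a, [] => if Q a then Complex.exp (-s * l a) else 0
  | a, b :: w => if N a b then Complex.exp (-s * l a) * pathWeight N l Q s b w else 0

open Classical in
theorem pathWeight_eq (s : ℂ) (a : A) (w : List A) : pathWeight N l Q s a w =
    if (a :: w).IsChain N ∧ Q ((a :: w).getLast (by simp)) then
      Complex.exp (-s * (((a :: w).map l).sum : ℝ)) else 0 := by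
  induction w generalizing a with
  | nil => simp [pathWeight]
  | cons b w ih =>
    rw [pathWeight, ih]
    simp only [List.isChain_cons_cons, List.getLast_cons_cons, List.map_cons, List.sum_cons]
    by_cases h1 : N a b
    · simp only [h1, if_true, true_and]
      split_ifs with h2
      · rw [← Complex.exp_add]; congr 1; push_cast; ring
      · simp
    · simp [h1]

theorem pathWeight_ofReal (σ : ℝ) (a : A) (w : List A) :
    pathWeight N l Q σ a w = (‖pathWeight N l Q σ a w‖ : ℂ) := by
  classical
  rw [pathWeight_eq]
  split_ifs
  · rw [← Complex.ofReal_neg, ← Complex.ofReal_mul, ← Complex.ofReal_exp, Complex.norm_real,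
      Real.norm_of_nonneg (Real.exp_pos _).le]
  · simp

end

section

variable {A : Type*} [Fintype A] {N : A → A → Prop} {l : A → ℝ}

open Classical in
/-- The complex transfer matrix. -/
noncomputable def transferMatrix (N : A → A → Prop) (l : A → ℝ) (s : ℂ) : Matrix A A ℂ :=
  Matrix.of fun a b => if N a b then Complex.exp (-s * l a) else 0

open Classical in
/-- The determinant `det (1 - M(s))` of the transfer matrix. -/
noncomputable def transferDet (N : A → A → Prop) (l : A → ℝ) (s : ℂ) : ℂ :=
  (1 - transferMatrix N l s).det

open Classical in
theorem transferMatrix_mulVec (s : ℂ) (x : A → ℂ) (a : A) :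
    (transferMatrix N l s).mulVec x a = Complex.exp (-s * l a) * ∑ b with N a b, x b := by
  simp [transferMatrix, Matrix.mulVec, dotProduct, Finset.sum_filter, Finset.mul_sum]

theorem norm_cexp_neg_mul (s : ℂ) (r : ℝ) : ‖Complex.exp (-s * r)‖ = Real.exp (-s.re * r) := by
  rw [Complex.norm_exp]; simp

theorem norm_le_transfer {s : ℂ} {x : A → ℂ} (hx : (transferMatrix N l s).mulVec x = x) (a : A) :
    ‖x a‖ ≤ transfer N l s.re (fun b => ‖x b‖) a := by
  classical
  conv_lhs => rw [← hx, transferMatrix_mulVec, norm_mul, norm_cexp_neg_mul]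
  exact mul_le_mul_of_nonneg_left (norm_sum_le _ _) (Real.exp_pos _).le

/-- Equality in the triangle inequality forces all summands to have the same phase. -/
theorem div_norm_eq_of_norm_sum_eq {ι : Type*} {t : Finset ι} {x : ι → ℂ}
    (h : ‖∑ i ∈ t, x i‖ = ∑ i ∈ t, ‖x i‖) {i : ι} (hi : i ∈ t) (hx : x i ≠ 0) :
    x i / ‖x i‖ = (∑ i ∈ t, x i) / ‖∑ i ∈ t, x i‖ := by
  set S := ∑ i ∈ t, x i with hS
  have hSpos : 0 < ‖S‖ := by
    rw [h]
    exact lt_of_lt_of_le (norm_pos_iff.2 hx)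
      (Finset.single_le_sum (f := fun i => ‖x i‖) (fun i _ => norm_nonneg _) hi)
  -- Pairing with the conjugate of S bounds each real part by |S||x_j|. The hypothesis makes the
  -- sums of both sides equal, so each bound is attained and conj(S) x_i is a nonnegative real.
  have hle : ∀ j ∈ t, ((starRingEnd ℂ) S * x j).re ≤ ‖S‖ * ‖x j‖ := by
    intro j _
    refine (Complex.re_le_norm _).trans ?_
    rw [norm_mul, RCLike.norm_conj]
  have hsum : ∑ j ∈ t, ((starRingEnd ℂ) S * x j).re = ∑ j ∈ t, ‖S‖ * ‖x j‖ := by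
    rw [← Complex.re_sum, ← Finset.mul_sum, ← hS, ← Finset.mul_sum, ← h,
      mul_comm, Complex.mul_conj, Complex.ofReal_re, Complex.normSq_eq_norm_sq]
    ring
  have heq := (Finset.sum_eq_sum_iff_of_le hle).1 hsum i hi
  have hn : ((starRingEnd ℂ) S * x i).re = ‖(starRingEnd ℂ) S * x i‖ := by
    rw [heq, norm_mul, RCLike.norm_conj]
  have hz := Complex.eq_coe_norm_of_nonneg (Complex.re_eq_norm.1 hn)
  rw [norm_mul, RCLike.norm_conj] at hz
  have h1 : (‖x i‖ : ℂ) ≠ 0 := by simpa using hx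
  have h2 : (‖S‖ : ℂ) ≠ 0 := by exact_mod_cast hSpos.ne'
  have h3 : S * (starRingEnd ℂ) S = (‖S‖ : ℂ) ^ 2 := Complex.mul_conj' S
  rw [div_eq_div_iff h1 h2]
  have h4 : (‖S‖ : ℂ) * (x i * ‖S‖) = (‖S‖ : ℂ) * (S * ‖x i‖) := by
    calc (‖S‖ : ℂ) * (x i * ‖S‖) = (‖S‖ : ℂ) ^ 2 * x i := by ring
      _ = S * ((starRingEnd ℂ) S * x i) := by rw [← h3]; ring
      _ = _ := by rw [hz]; push_cast; ring
  exact mul_left_cancel₀ h2 h4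

open Classical in
theorem transferDet_ne_zero [Nonempty A] (hl : ∀ a, 0 < l a)
    (hirr : ∀ a b, Relation.ReflTransGen N a b)
    (harith : ∀ t : ℝ, t ≠ 0 → ∀ θ : A → ℂ, (∀ a, ‖θ a‖ = 1) →
      ¬ ∀ a b, N a b → θ b = Complex.exp (t * Complex.I * l a) * θ a)
    {h : ℝ} {v : A → ℝ} (hv : ∀ a, 0 < v a) (hT : ∀ a, transfer N l h v a = v a)
    {s : ℂ} (hs : h ≤ s.re) (hne : s ≠ h) : transferDet N l s ≠ 0 := by
  intro hdet
  obtain ⟨x, hx0, hx⟩ := Matrix.exists_mulVec_eq_zero_iff.2 hdet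
  rw [Matrix.sub_mulVec, Matrix.one_mulVec, sub_eq_zero] at hx
  have hle := norm_le_transfer hx.symm
  rcases hs.lt_or_eq with hlt | heq
  · refine hx0 (funext fun a => norm_eq_zero.1 ?_)
    exact eq_zero_of_le_transfer hl hv hT hlt (x := fun a => ‖x a‖) (fun a => norm_nonneg _) hle a
  · have hle' := hle
    rw [← heq] at hle'
    obtain ⟨t, ht⟩ := eq_smul_of_le_transfer hirr hv hT hle'
    have hxne : ∀ a, x a ≠ 0 := by
      intro a ha
      have h0 := ht a
      simp only [ha, norm_zero] at h0
      have ht0 : t = 0 := by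
        rcases mul_eq_zero.1 h0.symm with h | h
        · exact h
        · exact absurd h (hv a).ne'
      refine hx0 (funext fun b => norm_eq_zero.1 ?_)
      simpa [ht0] using ht b
    refine harith s.im (fun him => hne (Complex.ext (by simpa using heq.symm) (by simpa using him)))
      (fun a => x a / ‖x a‖) (fun a => by simp [hxne a]) fun a b hab => ?_
    have hxa : x a = Complex.exp (-s * l a) * ∑ b with N a b, x b := by
      conv_lhs => rw [hx, transferMatrix_mulVec]
    -- Since |x| is a multiple of v, it is exactly fixed by L_h, so no absolute value is lost in the
    -- sum.
    have hsum : ‖∑ b with N a b, x b‖ = ∑ b with N a b, ‖x b‖ := by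
      have h1 : ‖x a‖ = transfer N l h (fun b => ‖x b‖) a := by
        have : (fun b => ‖x b‖) = fun b => t * v b := funext ht
        rw [this, transfer_smul, hT, ht]
      have h2 := congrArg norm hxa
      rw [norm_mul, norm_cexp_neg_mul, ← heq, h1] at h2
      exact (mul_left_cancel₀ (Real.exp_pos _).ne' h2).symm
    rw [div_norm_eq_of_norm_sum_eq hsum (by simpa using hab) (hxne b)]
    set S := ∑ b with N a b, x b
    have hS : (‖S‖ : ℂ) ≠ 0 := by
      intro h0
      apply hxne a
      rw [hxa, norm_eq_zero.1 (by exact_mod_cast h0 : ‖S‖ = 0), mul_zero]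
    rw [hxa, norm_mul, norm_cexp_neg_mul]
    have e1 : Complex.exp (-s * l a) =
        (Real.exp (-s.re * l a) : ℂ) * Complex.exp (-(s.im * Complex.I * l a)) := by
      rw [Complex.ofReal_exp, ← Complex.exp_add]
      congr 1
      conv_lhs => rw [← Complex.re_add_im s]
      push_cast; ring
    rw [e1]
    have h5 : ((Real.exp (-s.re * l a) : ℝ) : ℂ) ≠ 0 := by
      exact_mod_cast (Real.exp_pos _).ne'
    have h6 : Complex.exp (s.im * Complex.I * l a) * Complex.exp (-(s.im * Complex.I * l a)) = 1 := by
      rw [← Complex.exp_add]; simp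
    push_cast at *
    field_simp
    rw [mul_comm (Complex.exp _) (Complex.exp _)] at h6
    linear_combination (-S) * h6

/-- Lists are either empty or a head followed by a tail. -/
def sumProdEquivList (A : Type*) : Unit ⊕ A × List A ≃ List A where
  toFun x := x.elim (fun _ => []) fun p => p.1 :: p.2
  invFun w := match w with
    | [] => Sum.inl ()
    | a :: w => Sum.inr (a, w)
  left_inv x := by rcases x with _ | ⟨_, _⟩ <;> rfl
  right_inv w := by cases w <;> rfl

theorem tsum_list_ennreal (F : List A → ENNReal) :
    ∑' w, F w = F [] + ∑ a, ∑' w, F (a :: w) := by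
  rw [← (sumProdEquivList A).tsum_eq, Summable.tsum_sum ENNReal.summable ENNReal.summable,
    ENNReal.tsum_prod', tsum_fintype, tsum_fintype]
  simp [sumProdEquivList]

theorem tsum_list_complex {F : List A → ℂ} (hF : Summable F) :
    ∑' w, F w = F [] + ∑ a, ∑' w, F (a :: w) := by
  have hF' := (sumProdEquivList A).summable_iff.2 hF
  have h2 : Summable fun p : A × List A => F (p.1 :: p.2) :=
    hF'.comp_injective Sum.inr_injective
  have h3 : ∑' p : A × List A, F (p.1 :: p.2) = ∑ a, ∑' w, F (a :: w) :=
    (Summable.tsum_prod h2).trans (tsum_fintype _)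
  rw [← (sumProdEquivList A).tsum_eq, Summable.tsum_sum Summable.of_finite h2, ← h3, tsum_fintype]
  simp [sumProdEquivList]

variable {Q : A → Prop}

/-- The sum of the weights of all paths starting with `a`. -/
noncomputable def pathSeries (N : A → A → Prop) (l : A → ℝ) (Q : A → Prop) (s : ℂ) (a : A) : ℂ :=
  ∑' w, pathWeight N l Q s a w

/-- The function K v is a supersolution of the renewal equation obtained by splitting off the first
edge, so by induction it dominates every truncation to paths of bounded length. -/
theorem tsum_enorm_pathWeight_le {σ K : ℝ} {v : A → ℝ} (hK : 0 ≤ K) (hv : ∀ a, 0 < v a)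
    (hT : ∀ a, Real.exp (-σ * l a) + K * transfer N l σ v a ≤ K * v a) {s : ℂ} (hs : s.re = σ)
    (a : A) : ∑' w, ‖pathWeight N l Q s a w‖ₑ ≤ ENNReal.ofReal (K * v a) := by
  classical
  have trunc : ∀ n : ℕ, ∀ a, ∑' w : List A,
      (if w.length < n then ‖pathWeight N l Q s a w‖ₑ else 0) ≤ ENNReal.ofReal (K * v a) := by
    intro n
    induction n with
    | zero => intro a; simp
    | succ n ih =>
      intro a
      have hen : ‖Complex.exp (-s * l a)‖ₑ = ENNReal.ofReal (Real.exp (-σ * l a)) := by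
        rw [← ofReal_norm, norm_cexp_neg_mul, hs]
      rw [tsum_list_ennreal]
      have h1 : (if ([] : List A).length < n + 1 then ‖pathWeight N l Q s a []‖ₑ else 0) ≤
          ENNReal.ofReal (Real.exp (-σ * l a)) := by
        rw [if_pos (by simp), pathWeight]
        split_ifs
        · rw [hen]
        · simp
      have h2 : ∀ b, ∑' w : List A, (if (b :: w).length < n + 1 then
          ‖pathWeight N l Q s a (b :: w)‖ₑ else 0) ≤
          if N a b then ENNReal.ofReal (Real.exp (-σ * l a)) * ENNReal.ofReal (K * v b) else 0 := by
        intro b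
        simp only [pathWeight, List.length_cons, add_lt_add_iff_right]
        by_cases hab : N a b
        · simp only [hab, if_true, enorm_mul, hen]
          refine le_trans (le_of_eq ?_) (mul_le_mul_right (ih b) _)
          rw [← ENNReal.tsum_mul_left]
          simp only [mul_ite, mul_zero]
        · simp [hab]
      refine (add_le_add h1 (Finset.sum_le_sum fun b _ => h2 b)).trans ?_
      rw [← Finset.sum_filter, ← Finset.mul_sum, ← ENNReal.ofReal_sum_of_nonneg
        (fun b _ => mul_nonneg hK (hv b).le), ← ENNReal.ofReal_mul (Real.exp_pos _).le,
        ← ENNReal.ofReal_add (Real.exp_pos _).le (mul_nonneg (Real.exp_pos _).le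
          (Finset.sum_nonneg fun b _ => mul_nonneg hK (hv b).le))]
      refine ENNReal.ofReal_le_ofReal (le_trans (le_of_eq ?_) (hT a))
      rw [← transfer_smul]
      simp only [transfer]
  rw [ENNReal.tsum_eq_iSup_sum]
  -- A finite set of lists has bounded length, so its sum is below one of the truncations.
  refine iSup_le fun t => le_trans ?_ (trunc (t.sup List.length + 1) a)
  refine le_trans (Finset.sum_le_sum fun w hw => ?_) (ENNReal.sum_le_tsum t)
  rw [if_pos (Nat.lt_succ_of_le (Finset.le_sup (f := List.length) hw))]

/-- An explicit constant for which `tsum_enorm_pathWeight_le` applies. -/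
theorem exists_supersolution [Nonempty A] (hl : ∀ a, 0 < l a) {h : ℝ} (hh : 0 < h) {v : A → ℝ}
    (hv : ∀ a, 0 < v a) (hT : ∀ a, transfer N l h v a = v a) :
    ∃ K : ℝ → ℝ, (∀ σ, h < σ → 0 ≤ K σ ∧
      ∀ a, Real.exp (-σ * l a) + K σ * transfer N l σ v a ≤ K σ * v a) ∧
      ∃ C, ∀ σ, h < σ → σ ≤ h + 1 → K σ ≤ C / (σ - h) := by
  obtain ⟨a₀, ha₀⟩ := Finite.exists_min l
  obtain ⟨a₁, ha₁⟩ := Finite.exists_min v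
  have hρ : ∀ σ, h < σ → 0 < 1 - Real.exp (-(σ - h) * l a₀) := by
    intro σ hσ
    rw [sub_pos, Real.exp_lt_one_iff]; nlinarith [hl a₀]
  have hv1 := hv a₁
  have hl0 := hl a₀
  -- With ρ = e^{-(σ-h) min l}, one has v - L_σ v ≥ (1 - ρ) min v, so this K makes K(v - L_σ v) ≥ 1
  -- ≥ e^{-σ l}. Its growth near h follows from 1 - e^{-x} ≥ x/(1 + x).
  refine ⟨fun σ => 1 / ((1 - Real.exp (-(σ - h) * l a₀)) * v a₁), fun σ hσ => ⟨?_, fun a => ?_⟩,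
    (1 + l a₀) / (l a₀ * v a₁), fun σ hσ hσ1 => ?_⟩
  · have := hρ σ hσ
    positivity
  · have h1 := hρ σ hσ
    rw [transfer_exp h, hT]
    have h2 : Real.exp (-σ * l a) ≤ 1 := Real.exp_le_one_iff.2 (by nlinarith [hl a])
    have h3 : Real.exp (-(σ - h) * l a) ≤ Real.exp (-(σ - h) * l a₀) :=
      Real.exp_le_exp.2 (by nlinarith [ha₀ a])
    have h4 : 1 ≤ 1 / ((1 - Real.exp (-(σ - h) * l a₀)) * v a₁) *
        ((1 - Real.exp (-(σ - h) * l a₀)) * v a) := by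
      rw [one_div, ← div_eq_inv_mul, one_le_div (by positivity)]
      exact mul_le_mul_of_nonneg_left (ha₁ a) h1.le
    have h5 : 0 ≤ 1 / ((1 - Real.exp (-(σ - h) * l a₀)) * v a₁) := by positivity
    have h6 : Real.exp (-(σ - h) * l a) * v a ≤ Real.exp (-(σ - h) * l a₀) * v a :=
      mul_le_mul_of_nonneg_right h3 (hv a).le
    have h7 := mul_le_mul_of_nonneg_left h6 h5
    linarith
  · have hx : 0 < (σ - h) * l a₀ := mul_pos (by linarith) hl0
    have h1 : Real.exp (-(σ - h) * l a₀) ≤ 1 / (1 + (σ - h) * l a₀) := by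
      rw [neg_mul, Real.exp_neg, one_div]
      exact inv_anti₀ (by linarith) (by linarith [Real.add_one_le_exp ((σ - h) * l a₀)])
    have h2 : (σ - h) * l a₀ / (1 + l a₀) ≤ 1 - Real.exp (-(σ - h) * l a₀) := by
      have h3 : 1 - 1 / (1 + (σ - h) * l a₀) = (σ - h) * l a₀ / (1 + (σ - h) * l a₀) := by
        field_simp; ring
      have h4 : (σ - h) * l a₀ / (1 + l a₀) ≤ (σ - h) * l a₀ / (1 + (σ - h) * l a₀) := by
        apply div_le_div_of_nonneg_left hx.le (by linarith); nlinarith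
      linarith
    have hσh : 0 < σ - h := by linarith
    calc 1 / ((1 - Real.exp (-(σ - h) * l a₀)) * v a₁)
        ≤ 1 / ((σ - h) * l a₀ / (1 + l a₀) * v a₁) := by
          apply one_div_le_one_div_of_le (by positivity)
          exact mul_le_mul_of_nonneg_right h2 hv1.le
      _ = _ := by field_simp

theorem summable_pathWeight [Nonempty A] (hl : ∀ a, 0 < l a) {h : ℝ} (hh : 0 < h) {v : A → ℝ}
    (hv : ∀ a, 0 < v a) (hT : ∀ a, transfer N l h v a = v a) {s : ℂ} (hs : h < s.re) (a : A) :
    Summable fun w => pathWeight N l Q s a w := by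
  obtain ⟨K, hK, -⟩ := exists_supersolution hl hh hv hT
  have := tsum_enorm_pathWeight_le (Q := Q) (hK _ hs).1 hv (hK _ hs).2 rfl a
  apply Summable.of_norm
  have h2 := ENNReal.summable_toReal (ne_top_of_le_ne_top ENNReal.ofReal_ne_top this)
  simpa using h2

open Classical in
theorem pathSeries_eq {s : ℂ} (hs : ∀ a, Summable fun w => pathWeight N l Q s a w) (a : A) :
    pathSeries N l Q s a = (if Q a then Complex.exp (-s * l a) else 0) +
      (transferMatrix N l s).mulVec (pathSeries N l Q s) a := by
  rw [pathSeries, tsum_list_complex (hs a), transferMatrix_mulVec, Finset.sum_filter,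
    Finset.mul_sum]
  refine congrArg₂ _ rfl (Finset.sum_congr rfl fun b _ => ?_)
  simp only [pathWeight]
  by_cases hab : N a b
  · simp only [hab, if_true, tsum_mul_left]; rfl
  · simp [hab]

open Classical in
/-- The numerator in Cramer's rule for the path series. -/
noncomputable def pathNumerator (N : A → A → Prop) (l : A → ℝ) (Q : A → Prop) (s : ℂ) (a : A) :
    ℂ :=
  (1 - transferMatrix N l s).adjugate.mulVec
    (fun b => if Q b then Complex.exp (-s * l b) else 0) a

/-- Cramer's rule for the renewal system: multiplying by the adjugate exhibits the series as a
quotient of entire functions. -/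
theorem transferDet_mul_pathSeries {s : ℂ} (hs : ∀ a, Summable fun w => pathWeight N l Q s a w) (a : A) :
    transferDet N l s * pathSeries N l Q s a = pathNumerator N l Q s a := by
  classical
  have h1 : (1 - transferMatrix N l s).mulVec (pathSeries N l Q s) =
      fun b => if Q b then Complex.exp (-s * l b) else 0 := by
    funext a
    rw [Matrix.sub_mulVec, Matrix.one_mulVec, Pi.sub_apply, sub_eq_iff_eq_add]
    exact pathSeries_eq hs a
  rw [pathNumerator, ← h1, Matrix.mulVec_mulVec, Matrix.adjugate_mul, Matrix.smul_mulVec,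
    Matrix.one_mulVec, transferDet]
  rfl

theorem differentiable_transferDet : Differentiable ℂ fun s => transferDet N l s := by
  classical
  simp only [transferDet, Matrix.det_apply, Matrix.sub_apply, transferMatrix, Matrix.of_apply]
  refine Differentiable.fun_sum fun σ _ => Differentiable.const_smul ?_ _
  refine Differentiable.fun_finsetProd fun i _ => ?_
  split_ifs <;> fun_prop

theorem differentiable_pathNumerator (a : A) :
    Differentiable ℂ fun s => pathNumerator N l Q s a := by
  classical
  simp only [pathNumerator, Matrix.mulVec, dotProduct, Matrix.adjugate_apply]
  refine Differentiable.fun_sum fun b _ => Differentiable.mul ?_ ?_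
  · simp only [Matrix.det_apply, Matrix.updateRow_apply, Matrix.sub_apply, transferMatrix,
      Matrix.of_apply]
    refine Differentiable.fun_sum fun σ _ => Differentiable.const_smul ?_ _
    refine Differentiable.fun_finsetProd fun i _ => ?_
    split_ifs <;> fun_prop
  · split_ifs <;> fun_prop

end

end TransferOperator

/-! ### Behaviour of the series at the Perron exponent, and counting of chains -/

namespace TransferOperator

section

variable {A : Type*} [Fintype A] {N : A → A → Prop} {l : A → ℝ} {Q : A → Prop}

open Classical in
/-- Solutions of the renewal equation blow up at least like `1 / (σ - h)`. -/
theorem exists_lower_bound [Nonempty A] (hl : ∀ a, 0 < l a)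
    (hirr : ∀ a b, Relation.ReflTransGen N a b) {h : ℝ}
    {v : A → ℝ} (hv : ∀ a, 0 < v a) (hT : ∀ a, transfer (fun a b => N b a) l h v a = v a)
    (hQ : ∃ a, Q a) :
    ∃ c > 0, ∀ σ, h < σ → σ ≤ h + 1 → ∀ u : A → ℝ, (∀ a, 0 ≤ u a) →
      (∀ a, u a = (if Q a then Real.exp (-σ * l a) else 0) + transfer N l σ u a) →
      ∀ a, c / (σ - h) ≤ u a := by
  obtain ⟨a₀, ha₀⟩ := hQ
  obtain ⟨a₁, ha₁⟩ := Finite.exists_max l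
  have hκ : ∀ p : A × A, ∃ κ > 0, ∀ σ ≤ h + 1, ∀ u : A → ℝ, (∀ c, 0 ≤ u c) →
      (∀ c, transfer N l σ u c ≤ u c) → κ * u p.2 ≤ u p.1 := fun p =>
    exists_harnack hl (h + 1) (hirr p.1 p.2)
  choose κ hκ0 hκ using hκ
  obtain ⟨p, hp⟩ := Finite.exists_min κ
  -- The weights v(b)e^{h l(b)} form a left eigenvector of the transfer matrix at h, because `v` is
  -- a Perron function of the reversed relation.
  set W : ℝ := ∑ b, v b * Real.exp (h * l b) with hW
  have hWpos : 0 < W := Finset.sum_pos (fun b _ => mul_pos (hv b) (Real.exp_pos _))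
    Finset.univ_nonempty
  have hl1 := hl a₁
  have hκp := hκ0 p
  have hv0 := hv a₀
  refine ⟨κ p / W * (Real.exp (-l a₁) * v a₀ / l a₁), by positivity, fun σ hσ hσ1 u hu hu' a => ?_⟩
  have hsup : ∀ c, transfer N l σ u c ≤ u c := by
    intro c
    rw [hu' c]
    have : (0 : ℝ) ≤ if Q c then Real.exp (-σ * l c) else 0 := by split_ifs <;> positivity
    linarith
  set X : ℝ := ∑ b, v b * Real.exp (h * l b) * u b with hX
  have hXu : κ p * X ≤ W * u a := by
    rw [hX, hW, Finset.mul_sum, Finset.sum_mul]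
    refine Finset.sum_le_sum fun b _ => ?_
    have h1 := hκ (a, b) σ hσ1 u hu hsup
    have h2 : κ p * u b ≤ u a := (mul_le_mul_of_nonneg_right (hp (a, b)) (hu b)).trans h1
    have h3 : 0 ≤ v b * Real.exp (h * l b) := (mul_pos (hv b) (Real.exp_pos _)).le
    calc κ p * (v b * Real.exp (h * l b) * u b) = v b * Real.exp (h * l b) * (κ p * u b) := by ring
      _ ≤ _ := mul_le_mul_of_nonneg_left h2 h3
  set ρ : ℝ := Real.exp (-(σ - h) * l a₁) with hρ
  have hdual : ∑ b, v b * ∑ c with N b c, u c = X := by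
    simp only [Finset.sum_filter, Finset.mul_sum]
    rw [Finset.sum_comm, hX]
    refine Finset.sum_congr rfl fun c _ => ?_
    have h1 := hT c
    simp only [transfer, Finset.sum_filter] at h1
    have h2 : v c * Real.exp (h * l c) = ∑ b, if N b c then v b else 0 := by
      conv_lhs => rw [← h1]
      rw [mul_right_comm, ← Real.exp_add]; simp
    rw [h2, Finset.sum_mul]
    refine Finset.sum_congr rfl fun b _ => ?_
    split_ifs <;> simp
  -- Pairing the renewal equation with the left eigenvector yields (1 - ρ)X ≥ ρ v(a₀). As 1 - ρ ≤ (σ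
  -- - h) max l, the pairing X grows like 1/(σ - h), and the Harnack constant passes this to each
  -- coordinate.
  have hXlow : ρ * (v a₀ + X) ≤ X := by
    have h1 : v a₀ + X ≤ ∑ b, v b * ((if Q b then 1 else 0) + ∑ c with N b c, u c) := by
      simp only [mul_add, Finset.sum_add_distrib, hdual]
      refine add_le_add ?_ le_rfl
      have : v a₀ = v a₀ * (if Q a₀ then 1 else 0) := by simp [ha₀]
      rw [this]
      refine Finset.single_le_sum (f := fun b => v b * (if Q b then (1 : ℝ) else 0))
        (fun b _ => mul_nonneg (hv b).le (by split_ifs <;> norm_num)) (Finset.mem_univ a₀)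
    refine (mul_le_mul_of_nonneg_left h1 (Real.exp_pos _).le).trans ?_
    rw [Finset.mul_sum, hX]
    refine Finset.sum_le_sum fun b _ => ?_
    have h2 : u b = Real.exp (-σ * l b) * ((if Q b then 1 else 0) + ∑ c with N b c, u c) := by
      conv_lhs => rw [hu' b]
      rw [transfer, mul_add]
      split_ifs <;> simp
    have h3 : 0 ≤ (if Q b then (1 : ℝ) else 0) + ∑ c with N b c, u c :=
      add_nonneg (by split_ifs <;> norm_num) (Finset.sum_nonneg fun c _ => hu c)
    have h4 : ρ ≤ Real.exp (h * l b) * Real.exp (-σ * l b) := by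
      rw [hρ, ← Real.exp_add]
      exact Real.exp_le_exp.2 (by nlinarith [ha₁ b])
    rw [h2]
    calc ρ * (v b * ((if Q b then 1 else 0) + ∑ c with N b c, u c))
        = ρ * v b * ((if Q b then 1 else 0) + ∑ c with N b c, u c) := by ring
      _ ≤ Real.exp (h * l b) * Real.exp (-σ * l b) * v b *
          ((if Q b then 1 else 0) + ∑ c with N b c, u c) :=
        mul_le_mul_of_nonneg_right (mul_le_mul_of_nonneg_right h4 (hv b).le) h3
      _ = _ := by ring
  have hX0 : 0 ≤ X := Finset.sum_nonneg fun b _ =>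
    mul_nonneg (mul_pos (hv b) (Real.exp_pos _)).le (hu b)
  have hσh : 0 < σ - h := by linarith
  have h1 : 1 - ρ ≤ (σ - h) * l a₁ := by
    have := Real.add_one_le_exp (-(σ - h) * l a₁)
    rw [← hρ] at this; linarith
  have h2 : Real.exp (-l a₁) ≤ ρ := Real.exp_le_exp.2 (by nlinarith)
  have h3 : Real.exp (-l a₁) * v a₀ ≤ (σ - h) * l a₁ * X := by
    have e1 : Real.exp (-l a₁) * v a₀ ≤ ρ * v a₀ := mul_le_mul_of_nonneg_right h2 hv0.le
    have e2 := mul_le_mul_of_nonneg_right h1 hX0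
    linarith
  have h4 : Real.exp (-l a₁) * v a₀ / l a₁ ≤ X * (σ - h) := by
    rw [div_le_iff₀ hl1]; linarith
  rw [div_le_iff₀ hσh]
  calc κ p / W * (Real.exp (-l a₁) * v a₀ / l a₁) ≤ κ p / W * (X * (σ - h)) :=
        mul_le_mul_of_nonneg_left h4 (by positivity)
    _ = κ p * X * (σ - h) / W := by ring
    _ ≤ W * u a * (σ - h) / W := by gcongr
    _ = u a * (σ - h) := by field_simp

/-- On the real axis the path series is real and comparable with `1 / (σ - h)` near `h`. -/
theorem exists_pathSeries_bounds [Nonempty A] (hl : ∀ a, 0 < l a)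
    (hirr : ∀ a b, Relation.ReflTransGen N a b) {h : ℝ} (hh : 0 < h)
    {v : A → ℝ} (hv : ∀ a, 0 < v a) (hT : ∀ a, transfer N l h v a = v a)
    {v' : A → ℝ} (hv' : ∀ a, 0 < v' a)
    (hT' : ∀ a, transfer (fun a b => N b a) l h v' a = v' a) (hQ : ∃ a, Q a) :
    ∃ c > 0, ∃ C, ∀ σ : ℝ, h < σ → σ ≤ h + 1 → ∀ a,
      ∃ u : ℝ, pathSeries N l Q σ a = u ∧ c / (σ - h) ≤ u ∧ u ≤ C / (σ - h) := by
  classical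
  obtain ⟨c, hc, H⟩ := exists_lower_bound (Q := Q) hl hirr hv' hT' hQ
  obtain ⟨K, hK, C, hC⟩ := exists_supersolution hl hh hv hT
  obtain ⟨a₁, ha₁⟩ := Finite.exists_max v
  refine ⟨c, hc, C * v a₁, fun σ hσ hσ1 a => ?_⟩
  have hsum : ∀ a, Summable fun w => pathWeight N l Q σ a w := fun a =>
    summable_pathWeight hl hh hv hT (by simpa using hσ) a
  set u : A → ℝ := fun a => ∑' w, ‖pathWeight N l Q σ a w‖ with hu
  have hser : ∀ a, pathSeries N l Q σ a = u a := by
    intro a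
    rw [pathSeries, hu, Complex.ofReal_tsum]
    exact tsum_congr fun w => pathWeight_ofReal σ a w
  refine ⟨u a, hser a, H σ hσ hσ1 u (fun a => tsum_nonneg fun w => norm_nonneg _) (fun a => ?_) a,
    ?_⟩
  · have h1 := pathSeries_eq hsum a
    rw [transferMatrix_mulVec] at h1
    simp only [hser] at h1
    rw [transfer]
    apply Complex.ofReal_injective
    rw [h1]
    push_cast
    split_ifs <;> simp
  · have h1 := tsum_enorm_pathWeight_le (Q := Q) (s := σ) (hK σ hσ).1 hv (hK σ hσ).2 (by simp) a
    have h2 : ENNReal.ofReal (u a) ≤ ENNReal.ofReal (K σ * v a) := by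
      rw [hu, ENNReal.ofReal_tsum_of_nonneg (fun w => norm_nonneg _) (hsum a).norm]
      simpa using h1
    have h3 := (ENNReal.ofReal_le_ofReal_iff (mul_nonneg (hK σ hσ).1 (hv a).le)).1 h2
    calc u a ≤ K σ * v a := h3
      _ ≤ K σ * v a₁ := mul_le_mul_of_nonneg_left (ha₁ a) (hK σ hσ).1
      _ ≤ C / (σ - h) * v a₁ := mul_le_mul_of_nonneg_right (hC σ hσ hσ1) (hv a₁).le
      _ = _ := by ring

open Classical in
/-- The number of `N`-chains `a :: w` of length less than `T`. -/
noncomputable def chainCount (N : A → A → Prop) (l : A → ℝ) (a : A) (T : ℝ) : ENNReal :=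
  ∑' w : List A, if (a :: w).IsChain N ∧ ((a :: w).map l).sum < T then 1 else 0

open Classical in
theorem chainCount_eq (hl : ∀ a, 0 < l a) (a : A) (T : ℝ) :
    chainCount N l a T =
      if l a < T then 1 + ∑ b with N a b, chainCount N l b (T - l a) else 0 := by
  split_ifs with h
  · rw [chainCount, tsum_list_ennreal, Finset.sum_filter]
    refine congrArg₂ _ (by simp [h]) (Finset.sum_congr rfl fun b _ => ?_)
    split_ifs with hab
    · refine tsum_congr fun w => ?_
      simp only [List.isChain_cons_cons, hab, true_and, List.map_cons, List.sum_cons,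
        lt_sub_iff_add_lt']
    · simp [hab]
  · rw [chainCount, ENNReal.tsum_eq_zero]
    intro w
    rw [if_neg]
    rintro ⟨-, hw⟩
    have : 0 ≤ (w.map l).sum := List.sum_nonneg (by simpa using fun a _ => (hl a).le)
    simp only [List.map_cons, List.sum_cons] at hw
    linarith

/-- This is the fixed-point equation for v: multiples of v(a)e^{hT} solve the homogeneous part of
the recursion `chainCount_eq`. -/
theorem sum_ofReal_perron {h : ℝ} {v : A → ℝ} (hv : ∀ a, 0 < v a)
    (hT : ∀ a, transfer N l h v a = v a) {C : ℝ} (hC : 0 ≤ C) (a : A) (T : ℝ) [DecidablePred (N a)] :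
    ∑ b with N a b, ENNReal.ofReal (C * v b * Real.exp (h * (T - l a))) =
      ENNReal.ofReal (C * v a * Real.exp (h * T)) := by
  classical
  rw [← ENNReal.ofReal_sum_of_nonneg fun b _ => mul_nonneg (mul_nonneg hC (hv b).le)
    (Real.exp_pos _).le, ← Finset.sum_mul, ← Finset.mul_sum]
  congr 1
  have h1 := hT a
  have e : Real.exp (h * (T - l a)) = Real.exp (-h * l a) * Real.exp (h * T) := by
    rw [← Real.exp_add]; ring_nf
  rw [e]
  conv_rhs => rw [← h1, transfer]
  have h2 : ∑ b with N a b, v b = ∑ b ∈ @Finset.filter A (N a) (fun b => Classical.propDecidable _)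
    Finset.univ, v b := by congr
  rw [h2]; ring

theorem exists_chainCount_le [Nonempty A] (hl : ∀ a, 0 < l a)
    (hdeg : ∀ a, ∃ b c, b ≠ c ∧ N a b ∧ N a c) {h : ℝ} (hh : 0 < h) {v : A → ℝ}
    (hv : ∀ a, 0 < v a) (hT : ∀ a, transfer N l h v a = v a) :
    ∃ C : ℝ, 0 < C ∧ ∀ a T, 0 ≤ T → chainCount N l a T ≤ ENNReal.ofReal (C * Real.exp (h * T)) := by
  classical
  obtain ⟨a₀, ha₀⟩ := Finite.exists_min l
  obtain ⟨a₁, ha₁⟩ := Finite.exists_min v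
  obtain ⟨a₂, ha₂⟩ := Finite.exists_max v
  have hv1 := hv a₁
  have hv2 := hv a₂
  -- Strengthening the bound by 1 absorbs the inhomogeneous term: two successors contribute at least
  -- 2, which covers the recursion's own 1 and the added 1.
  have key : ∀ n : ℕ, ∀ a T, 0 ≤ T → T ≤ n * l a₀ →
      chainCount N l a T + 1 ≤ ENNReal.ofReal ((v a₁)⁻¹ * v a * Real.exp (h * T)) := by
    have base : ∀ a T, 0 ≤ T → 1 ≤ ENNReal.ofReal ((v a₁)⁻¹ * v a * Real.exp (h * T)) := by
      intro a T h0
      rw [← ENNReal.ofReal_one]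
      apply ENNReal.ofReal_le_ofReal
      have e1 : 1 ≤ (v a₁)⁻¹ * v a := by
        rw [← div_eq_inv_mul, one_le_div hv1]; exact ha₁ a
      have e2 : 1 ≤ Real.exp (h * T) := Real.one_le_exp (by positivity)
      nlinarith
    intro n
    induction n with
    | zero =>
      intro a T h0 h1
      rw [chainCount_eq hl, if_neg (by have := hl a; simp at h1; linarith), zero_add]
      exact base a T h0
    | succ n ih =>
      intro a T h0 h1
      rw [chainCount_eq hl]
      split_ifs with hlt
      · obtain ⟨b, c, hbc, hb, hc⟩ := hdeg a
        have hcard : 1 < (Finset.univ.filter fun b => N a b).card :=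
          Finset.one_lt_card.2 ⟨b, by simpa using hb, c, by simpa using hc, hbc⟩
        have h2 : (2 : ENNReal) ≤ ∑ b with N a b, 1 := by
          simp only [Finset.sum_const, nsmul_eq_mul, mul_one]
          exact_mod_cast hcard
        calc 1 + ∑ b with N a b, chainCount N l b (T - l a) + 1
            = ∑ b with N a b, chainCount N l b (T - l a) + 2 := by ring
          _ ≤ ∑ b with N a b, chainCount N l b (T - l a) + ∑ b with N a b, 1 := by gcongr
          _ = ∑ b with N a b, (chainCount N l b (T - l a) + 1) := Finset.sum_add_distrib.symm
          _ ≤ ∑ b with N a b, ENNReal.ofReal ((v a₁)⁻¹ * v b * Real.exp (h * (T - l a))) := by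
            refine Finset.sum_le_sum fun b _ => ih b (T - l a) (by linarith) ?_
            have := ha₀ a
            push_cast at h1
            linarith
          _ = _ := sum_ofReal_perron hv hT (by positivity) a T
      · rw [zero_add]; exact base a T h0
  refine ⟨(v a₁)⁻¹ * v a₂, by positivity, fun a T h0 => ?_⟩
  have hn : T ≤ ⌈T / l a₀⌉₊ * l a₀ := by
    rw [← div_le_iff₀ (hl a₀)]; exact Nat.le_ceil _
  refine (le_self_add.trans (key _ a T h0 hn)).trans (ENNReal.ofReal_le_ofReal ?_)
  have := ha₂ a
  gcongr

theorem exists_le_chainCount [Nonempty A] (hl : ∀ a, 0 < l a) {h : ℝ} (hh : 0 < h) {v : A → ℝ}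
    (hv : ∀ a, 0 < v a) (hT : ∀ a, transfer N l h v a = v a) :
    ∃ c : ℝ, 0 < c ∧ ∀ a T, ENNReal.ofReal (c * Real.exp (h * T)) ≤ chainCount N l a T + 1 := by
  classical
  obtain ⟨a₀, ha₀⟩ := Finite.exists_min l
  obtain ⟨a₁, ha₁⟩ := Finite.exists_min v
  obtain ⟨a₂, ha₂⟩ := Finite.exists_max v
  obtain ⟨a₃, ha₃⟩ := Finite.exists_max l
  have hv1 := hv a₁
  have hv2 := hv a₂
  -- The slack k = 1/|A| is small enough that its sum over all successors is at most the 1 supplied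
  -- by the recursion.
  set k : ℝ := (Fintype.card A : ℝ)⁻¹ with hk
  have hkpos : 0 < k := by rw [hk]; have : 0 < Fintype.card A := Fintype.card_pos; positivity
  have hk1 : k ≤ 1 := inv_le_one_of_one_le₀ (by exact_mod_cast Fintype.card_pos)
  set c : ℝ := k / (v a₂ * Real.exp (h * l a₃)) with hc
  have hcpos : 0 < c := by positivity
  have base : ∀ a T, T ≤ l a → ENNReal.ofReal (c * v a * Real.exp (h * T)) ≤ ENNReal.ofReal k := by
    intro a T hTa
    apply ENNReal.ofReal_le_ofReal
    have e1 : Real.exp (h * T) ≤ Real.exp (h * l a₃) :=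
      Real.exp_le_exp.2 (mul_le_mul_of_nonneg_left (hTa.trans (ha₃ a)) hh.le)
    have e2 := ha₂ a
    calc c * v a * Real.exp (h * T) ≤ c * v a₂ * Real.exp (h * l a₃) := by gcongr
      _ = k := by rw [hc]; field_simp
  have key : ∀ n : ℕ, ∀ a T, T ≤ n * l a₀ →
      ENNReal.ofReal (c * v a * Real.exp (h * T)) ≤ chainCount N l a T + ENNReal.ofReal k := by
    intro n
    induction n with
    | zero =>
      intro a T h1
      exact (base a T (by have := hl a; simp at h1; linarith)).trans le_add_self
    | succ n ih =>
      intro a T h1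
      by_cases hlt : l a < T
      · rw [chainCount_eq hl, if_pos hlt]
        have h2 : ∑ b with N a b, ENNReal.ofReal k ≤ 1 := by
          refine (Finset.sum_le_sum_of_subset (Finset.filter_subset _ _)).trans ?_
          rw [Finset.sum_const, nsmul_eq_mul, Finset.card_univ, ← ENNReal.ofReal_natCast,
            ← ENNReal.ofReal_mul (by positivity), ← ENNReal.ofReal_one]
          apply ENNReal.ofReal_le_ofReal
          rw [hk, mul_inv_cancel₀]
          have : 0 < Fintype.card A := Fintype.card_pos
          positivity
        calc ENNReal.ofReal (c * v a * Real.exp (h * T))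
            = ∑ b with N a b, ENNReal.ofReal (c * v b * Real.exp (h * (T - l a))) :=
              (sum_ofReal_perron hv hT hcpos.le a T).symm
          _ ≤ ∑ b with N a b, (chainCount N l b (T - l a) + ENNReal.ofReal k) := by
            refine Finset.sum_le_sum fun b _ => ih b (T - l a) ?_
            have := ha₀ a
            push_cast at h1
            linarith
          _ = ∑ b with N a b, ENNReal.ofReal k + ∑ b with N a b, chainCount N l b (T - l a) := by
            rw [Finset.sum_add_distrib, add_comm]
          _ ≤ 1 + ∑ b with N a b, chainCount N l b (T - l a) := by gcongr
          _ ≤ _ := le_self_add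
      · exact (base a T (not_lt.1 hlt)).trans le_add_self
  refine ⟨c * v a₁, by positivity, fun a T => ?_⟩
  have hn : T ≤ ⌈T / l a₀⌉₊ * l a₀ := by
    rw [← div_le_iff₀ (hl a₀)]; exact Nat.le_ceil _
  refine (ENNReal.ofReal_le_ofReal ?_).trans ((key _ a T hn).trans ?_)
  · have := ha₁ a
    gcongr
  · gcongr
    exact ENNReal.ofReal_le_one.2 hk1

end

end TransferOperator

/-! ### Simple poles from bounds on the real axis -/

/-- A quotient of entire functions which is bounded above and below by multiples of `1 / (σ - h)` on
the real axis to the right of `h` has a simple pole with positive residue at `h`. -/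
theorem hasSimplePoleAt_of_bounds {F P : ℂ → ℂ} {h : ℝ} (hF : AnalyticAt ℂ F h)
    (hP : AnalyticAt ℂ P h) {c C : ℝ} (hc : 0 < c)
    (hb : ∀ᶠ σ : ℝ in 𝓝[>] h, ∃ u : ℝ, F σ / P σ = u ∧ c / (σ - h) ≤ u ∧ u ≤ C / (σ - h)) :
    ∃ r : ℝ, 0 < r ∧ HasSimplePoleAt (fun s => F s / P s) h r := by
  set f : ℂ → ℂ := fun s => (s - h) * (F s / P s) with hf
  have hmer : MeromorphicAt f h := by
    apply MeromorphicAt.mul (by fun_prop)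
    exact hF.meromorphicAt.div hP.meromorphicAt
  have hreal : Tendsto (fun σ : ℝ => (σ : ℂ)) (𝓝[>] h) (𝓝[≠] (h : ℂ)) := by
    refine tendsto_nhdsWithin_iff.2
      ⟨(Complex.continuous_ofReal.tendsto h).mono_left nhdsWithin_le_nhds, ?_⟩
    filter_upwards [self_mem_nhdsWithin] with σ hσ
    simpa using (ne_of_gt (show h < σ from hσ))
  have hb' : ∀ᶠ σ : ℝ in 𝓝[>] h, ∃ u : ℝ, f σ = u ∧ c ≤ u ∧ u ≤ C := by
    filter_upwards [hb, self_mem_nhdsWithin] with σ ⟨u, h1, h2, h3⟩ hσ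
    have hpos : 0 < σ - h := sub_pos.2 hσ
    refine ⟨(σ - h) * u, by rw [hf]; simp only [h1]; push_cast; ring, ?_, ?_⟩
    · rw [div_le_iff₀ hpos] at h2; linarith
    · rw [le_div_iff₀ hpos] at h3; linarith
  -- A negative order would make |f| tend to infinity at h, but f is at most C on the real ray; an
  -- infinite order is excluded likewise by the lower bound c.
  have hord : 0 ≤ meromorphicOrderAt f h := by
    by_contra hneg
    have h1 := (tendsto_cobounded_of_meromorphicOrderAt_neg (not_le.1 hneg)).comp hreal
    rw [← tendsto_norm_atTop_iff_cobounded] at h1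
    obtain ⟨σ, ⟨u, hu, hcu, huC⟩, hσ⟩ := (hb'.and (h1.eventually_gt_atTop C)).exists
    simp only [Function.comp, hu, Complex.norm_real, Real.norm_eq_abs] at hσ
    rw [abs_of_pos (hc.trans_le hcu)] at hσ
    linarith
  have hne : meromorphicOrderAt f h ≠ ⊤ := by
    intro htop
    have h1 := hreal.eventually (meromorphicOrderAt_eq_top_iff.1 htop)
    obtain ⟨σ, ⟨u, hu, hcu, huC⟩, hσ⟩ := (hb'.and h1).exists
    rw [hu] at hσ
    have : u = 0 := by exact_mod_cast hσ
    linarith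
  obtain ⟨g, hg, hfg⟩ : ∃ g : ℂ → ℂ, AnalyticAt ℂ g h ∧ ∀ᶠ s in 𝓝[≠] (h : ℂ), f s = g s := by
    lift meromorphicOrderAt f h to ℤ using hne with n hn
    obtain ⟨g, hg, -, hfg⟩ := (meromorphicOrderAt_eq_int_iff hmer).1 hn.symm
    lift n to ℕ using (by exact_mod_cast hord) with m
    refine ⟨fun s => (s - h) ^ m * g s, by fun_prop, ?_⟩
    filter_upwards [hfg] with s hs
    simpa using hs
  have hlim : Tendsto (fun σ : ℝ => f σ) (𝓝[>] h) (𝓝 (g h)) := by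
    have h1 : Tendsto g (𝓝[≠] (h : ℂ)) (𝓝 (g h)) :=
      hg.continuousAt.tendsto.mono_left nhdsWithin_le_nhds
    exact ((tendsto_congr' hfg).2 h1).comp hreal
  have him : (g h).im = 0 := by
    refine tendsto_nhds_unique ((Complex.continuous_im.tendsto _).comp hlim)
      (tendsto_const_nhds.congr' ?_)
    filter_upwards [hb'] with σ ⟨u, hu, _⟩
    simp [hu]
  have hre : c ≤ (g h).re := by
    refine ge_of_tendsto ((Complex.continuous_re.tendsto _).comp hlim) ?_
    filter_upwards [hb'] with σ ⟨u, hu, h2, _⟩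
    simpa [hu] using h2
  have hgh : g h = ((g h).re : ℂ) := Complex.ext rfl (by simpa using him)
  -- The residue is the value at h of the analytic extension g of (s - h)F/P, and the regular part
  -- is the difference quotient (g(s) - g(h))/(s - h).
  refine ⟨(g h).re, by linarith, ?_, dslope g h, ?_, ?_⟩
  · exact_mod_cast (by linarith : (0 : ℝ) < (g h).re).ne'
  · obtain ⟨p, hp⟩ := hg
    exact ⟨_, hp.has_fpower_series_dslope_fslope⟩
  · filter_upwards [hfg, self_mem_nhdsWithin] with s hs hsne
    have h1 : s - h ≠ 0 := sub_ne_zero.2 hsne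
    rw [← hgh, dslope_of_ne _ hsne, slope_def_field, ← hs, hf]
    field_simp
    ring

theorem exists_meromorphic_extension {F P η : ℂ → ℂ} {h : ℝ} (hF : Differentiable ℂ F)
    (hP : Differentiable ℂ P) (hPne : ∀ s : ℂ, h ≤ s.re → s ≠ h → P s ≠ 0)
    (hη : ∀ s : ℂ, h < s.re → P s * η s = F s) {c C : ℝ} (hc : 0 < c)
    (hb : ∀ᶠ σ : ℝ in 𝓝[>] h, ∃ u : ℝ, η σ = u ∧ c / (σ - h) ≤ u ∧ u ≤ C / (σ - h)) :
    AnalyticOnNhd ℂ η {s : ℂ | h < s.re} ∧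
    ∃ (c : ℝ) (U : Set ℂ) (f : ℂ → ℂ), 0 < c ∧ IsOpen U ∧ {s : ℂ | h ≤ s.re} ⊆ U ∧
      AnalyticOnNhd ℂ f (U \ {(h : ℂ)}) ∧ (∀ s : ℂ, h < s.re → f s = η s) ∧
      HasSimplePoleAt f h c := by
  have hne : ∀ s : ℂ, h < s.re → P s ≠ 0 := fun s hs =>
    hPne s hs.le (fun e => by simp [e] at hs)
  have hηeq : ∀ s : ℂ, h < s.re → F s / P s = η s := fun s hs => by
    rw [div_eq_iff (hne s hs), ← hη s hs, mul_comm]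
  have han : ∀ s, P s ≠ 0 → AnalyticAt ℂ (fun s => F s / P s) s := fun s hs =>
    (hF.analyticAt s).fun_div (hP.analyticAt s) hs
  have hopen : IsOpen {s : ℂ | h < s.re} := isOpen_lt continuous_const Complex.continuous_re
  refine ⟨fun s hs => (han s (hne s hs)).congr ?_, ?_⟩
  · filter_upwards [hopen.mem_nhds hs] with z hz using hηeq z hz
  -- P cannot vanish identically near h, as it is nonzero on the real axis just to the right. This
  -- isolates its possible zero at h and makes the set U below open.
  have hpunct : ∀ᶠ s in 𝓝[≠] (h : ℂ), P s ≠ 0 := by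
    rcases (hP.analyticAt (h : ℂ)).eventually_eq_zero_or_eventually_ne_zero with h0 | h0
    · have hreal : Tendsto (fun σ : ℝ => (σ : ℂ)) (𝓝[>] h) (𝓝 (h : ℂ)) :=
        (Complex.continuous_ofReal.tendsto h).mono_left nhdsWithin_le_nhds
      obtain ⟨σ, h1, h2⟩ := ((hreal.eventually h0).and self_mem_nhdsWithin).exists
      exact absurd h1 (hne σ (by simpa using h2))
    · exact h0
  obtain ⟨r, hr, hpole⟩ := hasSimplePoleAt_of_bounds (hF.analyticAt h) (hP.analyticAt h) hc (by
    filter_upwards [hb, self_mem_nhdsWithin] with σ ⟨u, h1, h2⟩ hσ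
    exact ⟨u, by rw [hηeq σ (by simpa using hσ), h1], h2⟩)
  refine ⟨r, {s | P s ≠ 0} ∪ {(h : ℂ)}, fun s => F s / P s, hr, ?_, ?_, ?_, hηeq, hpole⟩
  · rw [isOpen_iff_mem_nhds]
    rintro s (hs | rfl)
    · exact mem_of_superset ((isOpen_ne_fun hP.continuous continuous_const).mem_nhds hs)
        Set.subset_union_left
    · rw [eventually_nhdsWithin_iff] at hpunct
      filter_upwards [hpunct] with z hz
      by_cases hzh : z = h
      · exact Or.inr hzh
      · exact Or.inl (hz hzh)
  · intro s hs
    by_cases hsh : s = h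
    · exact Or.inr hsh
    · exact Or.inl (hPne s hs hsh)
  · rintro s ⟨hs | hs, hs'⟩
    · exact han s hs
    · exact absurd hs hs'

/-! ### Reduced paths and distances in the universal cover -/

namespace MetricGraph

section

variable {V E : Type*} (G : MetricGraph V E)

@[simp] theorem rev_rev (a : E × Bool) : rev (rev a) = a := by simp [rev]

@[simp] theorem initial_rev (a : E × Bool) : G.initial (rev a) = G.terminal a := by
  rcases a with ⟨e, _ | _⟩ <;> rfl

@[simp] theorem terminal_rev (a : E × Bool) : G.terminal (rev a) = G.initial a := by
  rcases a with ⟨e, _ | _⟩ <;> rfl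

theorem ne_rev_iff {a b : E × Bool} : b ≠ rev a ↔ (a.1 = b.1 → a.2 = b.2) := by
  rcases a with ⟨e, _ | _⟩ <;> rcases b with ⟨f, _ | _⟩ <;> simp [rev, eq_comm]

/-- The oriented edge `b` can follow `a` in a non-backtracking path. -/
def Follows (a b : E × Bool) : Prop := G.terminal a = G.initial b ∧ b ≠ rev a

/-- The length of an oriented edge. -/
def orientedLength (a : E × Bool) : ℝ := G.length a.1

theorem orientedLength_pos (a : E × Bool) : 0 < G.orientedLength a := G.length_pos a.1

variable {G}

theorem Follows.symm_rev {a b : E × Bool} (h : G.Follows a b) : G.Follows (rev b) (rev a) := by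
  refine ⟨by simpa using h.1.symm, fun e => h.2 ?_⟩
  rw [e, rev_rev]

theorem IsPath.unique {u v v' : V} {w : List (E × Bool)} (h : G.IsPath u w v)
    (h' : G.IsPath u w v') : v = v' := by
  induction w generalizing u with
  | nil => exact h.symm.trans h'
  | cons a w ih => exact ih h.2 h'.2

theorem isPath_append_iff {u x : V} {w z : List (E × Bool)} :
    G.IsPath u (w ++ z) x ↔ ∃ v, G.IsPath u w v ∧ G.IsPath v z x := by
  refine ⟨fun h => ?_, fun ⟨v, h, h'⟩ => G.isPath_append h h'⟩
  induction w generalizing u with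
  | nil => exact ⟨u, rfl, h⟩
  | cons a w ih =>
    obtain ⟨v, h1, h2⟩ := ih h.2
    exact ⟨v, ⟨h.1, h1⟩, h2⟩

theorem IsPath.step {u v : V} {w z : List (E × Bool)} (h : G.IsPath u w v)
    (hs : FreeGroup.Red.Step w z) : G.IsPath u z v := by
  obtain ⟨⟩ := hs
  rename_i L₁ L₂ e b
  obtain ⟨x, h1, h2⟩ := isPath_append_iff.1 h
  refine G.isPath_append h1 ?_
  obtain ⟨h3, h4, h5⟩ := h2
  have : G.terminal (e, !b) = x := by rw [← h3, ← G.terminal_rev]; rfl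
  rwa [this] at h5

theorem IsPath.red {u v : V} {w z : List (E × Bool)} (h : G.IsPath u w v)
    (hs : FreeGroup.Red w z) : G.IsPath u z v := by
  induction hs with
  | refl => exact h
  | tail _ hs ih => exact ih.step hs

theorem IsPath.toWord [DecidableEq E] {u v : V} {w : List (E × Bool)} (h : G.IsPath u w v)
    {g : FreeGroup E} (hg : FreeGroup.mk w = g) : G.IsPath u g.toWord v := by
  rw [← hg, FreeGroup.toWord_mk]
  exact h.red FreeGroup.reduce.red

theorem pathLength_append (w z : List (E × Bool)) :
    G.pathLength (w ++ z) = G.pathLength w + G.pathLength z := by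
  simp [pathLength]

theorem pathLength_cons (a : E × Bool) (w : List (E × Bool)) :
    G.pathLength (a :: w) = G.length a.1 + G.pathLength w := by
  simp [pathLength]

theorem pathLength_nonneg (w : List (E × Bool)) : 0 ≤ G.pathLength w :=
  List.sum_nonneg (by
    intro x hx
    obtain ⟨a, _, rfl⟩ := List.mem_map.1 hx
    exact (G.length_pos a.1).le)

theorem pathLength_invRev (w : List (E × Bool)) :
    G.pathLength (FreeGroup.invRev w) = G.pathLength w := by
  simp [pathLength, FreeGroup.invRev, List.sum_reverse, Function.comp_def]

theorem pathLength_le_of_red {w z : List (E × Bool)} (h : FreeGroup.Red w z) :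
    G.pathLength z ≤ G.pathLength w := by
  induction h with
  | refl => exact le_rfl
  | tail _ hs ih =>
    refine le_trans ?_ ih
    cases hs with | @not L₁ L₂ e b
    simp only [pathLength_append, pathLength_cons]
    linarith [G.length_pos e]

theorem isPath_cons_iff {u v : V} {a : E × Bool} {w : List (E × Bool)} :
    G.IsPath u (a :: w) v ↔ G.initial a = u ∧
      (a :: w).IsChain (fun a b => G.terminal a = G.initial b) ∧
      G.terminal ((a :: w).getLast (by simp)) = v := by
  induction w generalizing a u with
  | nil => simp [IsPath]
  | cons b w ih =>
    rw [IsPath, ih]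
    simp only [List.isChain_cons_cons, List.getLast_cons_cons, and_assoc]
    constructor
    · rintro ⟨h1, h2, h3⟩; exact ⟨h1, h2.symm, h3⟩
    · rintro ⟨h1, h2, h3⟩; exact ⟨h1, h2.symm, h3⟩

theorem isChain_follows_iff {w : List (E × Bool)} : w.IsChain G.Follows ↔
    w.IsChain (fun a b => G.terminal a = G.initial b) ∧ FreeGroup.IsReduced w := by
  have : G.Follows = fun a b => G.terminal a = G.initial b ∧ (a.1 = b.1 → a.2 = b.2) := by
    funext a b; exact propext (and_congr_right fun _ => ne_rev_iff)
  rw [this, FreeGroup.IsReduced]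
  induction w with
  | nil => simp
  | cons a w ih =>
    cases w with
    | nil => simp
    | cons b w =>
      simp only [List.isChain_cons_cons] at ih ⊢
      tauto

/-- The projection of a list of oriented edges of the universal cover to the graph. -/
def projPath (v₀ : V) (W : List (CoverEdge G v₀ × Bool)) : List (E × Bool) :=
  W.map fun q => (q.1.1.2, q.2)

variable {v₀ : V}

theorem pathLength_projPath (W : List (CoverEdge G v₀ × Bool)) :
    G.pathLength (projPath v₀ W) = (G.universalCover v₀).pathLength W := by
  simp only [pathLength, projPath, List.map_map]; rfl

/-- Each cover edge multiplies the free-group coordinate by its label, so the product telescopes.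
All cover paths with the same ends therefore have the same reduction, which is the shortest of them.
-/
theorem IsPath.proj {o p : CoverVertex G v₀} {W : List (CoverEdge G v₀ × Bool)}
    (h : (G.universalCover v₀).IsPath o W p) :
    FreeGroup.mk (projPath v₀ W) = o.1.2⁻¹ * p.1.2 := by
  induction W generalizing o with
  | nil => cases h; rw [inv_mul_cancel]; rfl
  | cons q W ih =>
    have h1 : FreeGroup.mk (projPath v₀ (q :: W)) =
        FreeGroup.mk [(q.1.1.2, q.2)] * FreeGroup.mk (projPath v₀ W) := by
      rw [FreeGroup.mul_mk]; rfl
    rw [h1, ih h.2, ← h.1]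
    obtain ⟨q, _ | _⟩ := q
    · have e : FreeGroup.mk [(q.1.2, false)] = (FreeGroup.of q.1.2)⁻¹ := rfl
      change FreeGroup.mk [(q.1.2, false)] * (q.1.1.1.2⁻¹ * p.1.2) =
        (q.1.1.1.2 * FreeGroup.of q.1.2)⁻¹ * p.1.2
      rw [e]; group
    · change FreeGroup.of q.1.2 * ((q.1.1.1.2 * FreeGroup.of q.1.2)⁻¹ * p.1.2) =
        q.1.1.1.2⁻¹ * p.1.2
      group

theorem exists_coverEdge {o : CoverVertex G v₀} {a : E × Bool} (ha : G.initial a = o.1.1) :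
    ∃ q : CoverEdge G v₀, q.1.2 = a.1 ∧ (G.universalCover v₀).initial (q, a.2) = o ∧
      ((G.universalCover v₀).terminal (q, a.2)).1 = (G.terminal a, o.1.2 * FreeGroup.mk [a]) := by
  obtain ⟨e, _ | _⟩ := a
  -- Cover edges are indexed by their source. For an edge traversed backwards from `o` this source
  -- is the class of `w` followed by `(e, false)`.
  · obtain ⟨⟨v, g⟩, w, hw, hg⟩ := o
    refine ⟨⟨(⟨(G.src e, g * FreeGroup.mk [(e, false)]), w ++ [(e, false)],
      G.isPath_append hw ⟨ha, rfl⟩, by rw [← FreeGroup.mul_mk, hg]⟩, e), rfl⟩, rfl, ?_, rfl⟩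
    refine Subtype.ext (Prod.ext ha ?_)
    change g * (FreeGroup.of e)⁻¹ * FreeGroup.of e = g
    group
  · exact ⟨⟨(o, e), ha.symm⟩, rfl, rfl, rfl⟩

theorem exists_lift {o : CoverVertex G v₀} {w : List (E × Bool)} {v : V}
    (h : G.IsPath o.1.1 w v) : ∃ (p : CoverVertex G v₀) (W : List (CoverEdge G v₀ × Bool)),
      (G.universalCover v₀).IsPath o W p ∧ projPath v₀ W = w ∧
      p.1 = (v, o.1.2 * FreeGroup.mk w) := by
  induction w generalizing o with
  | nil => exact ⟨o, [], rfl, rfl, Prod.ext h (by rw [← FreeGroup.one_eq_mk, mul_one])⟩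
  | cons a w ih =>
    obtain ⟨q, hq, hi, ht⟩ := exists_coverEdge h.1
    obtain ⟨p, W, h1, h2, h3⟩ := ih (o := (G.universalCover v₀).terminal (q, a.2))
      (by rw [ht]; exact h.2)
    refine ⟨p, (q, a.2) :: W, ⟨hi, h1⟩, ?_, ?_⟩
    · rw [← h2, projPath, List.map_cons, hq]; rfl
    · rw [h3, ht, mul_assoc, FreeGroup.mul_mk]; rfl

theorem isPath_toWord_cover [DecidableEq E] (o p : CoverVertex G v₀) :
    G.IsPath o.1.1 (o.1.2⁻¹ * p.1.2).toWord p.1.1 := by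
  obtain ⟨⟨v, g⟩, w, hw, hg⟩ := o
  obtain ⟨⟨v', g'⟩, w', hw', hg'⟩ := p
  refine (G.isPath_append (G.isPath_invRev hw) hw').toWord ?_
  exact FreeGroup.mul_mk.symm.trans (congrArg₂ (· * ·) (FreeGroup.inv_mk.symm.trans
    (congrArg (·⁻¹) hg)) hg')

theorem coverVertex_ext {p p' : CoverVertex G v₀} (o : CoverVertex G v₀) {w : List (E × Bool)}
    (h : G.IsPath o.1.1 w p.1.1) (h' : G.IsPath o.1.1 w p'.1.1) (he : p.1.2 = p'.1.2) : p = p' :=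
  Subtype.ext (Prod.ext (h.unique h') he)

/-- The distance in the universal cover is the length of the reduced path. -/
theorem vertexDist_universalCover [DecidableEq E] (o p : CoverVertex G v₀) :
    (G.universalCover v₀).vertexDist o p = G.pathLength (o.1.2⁻¹ * p.1.2).toWord := by
  obtain ⟨p', W, h1, h2, h3⟩ := exists_lift (isPath_toWord_cover o p)
  have hp : p' = p := by
    refine Subtype.ext ?_
    rw [h3, FreeGroup.mk_toWord, mul_inv_cancel_left]
  subst hp
  refine le_antisymm (csInf_le ⟨0, ?_⟩ ⟨W, h1, ?_⟩) (le_csInf ⟨_, W, h1, rfl⟩ ?_)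
  · rintro _ ⟨W, _, rfl⟩
    exact pathLength_nonneg W
  · rw [← pathLength_projPath, h2]
  · rintro _ ⟨W', hW', rfl⟩
    rw [← hW'.proj, FreeGroup.toWord_mk, ← pathLength_projPath]
    exact pathLength_le_of_red FreeGroup.reduce.red

/-- The vertices of the universal cover correspond to reduced paths from a base point. -/
noncomputable def coverVertexEquiv [DecidableEq E] (o : CoverVertex G v₀) : CoverVertex G v₀ ≃
    {w : List (E × Bool) // FreeGroup.IsReduced w ∧ ∃ v, G.IsPath o.1.1 w v} :=
  Equiv.ofBijective
    (fun p => ⟨(o.1.2⁻¹ * p.1.2).toWord, FreeGroup.isReduced_toWord, _, isPath_toWord_cover o p⟩)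
    ⟨fun p p' h => by
      have h1 : (o.1.2⁻¹ * p.1.2).toWord = (o.1.2⁻¹ * p'.1.2).toWord := congrArg Subtype.val h
      refine coverVertex_ext o (isPath_toWord_cover o p) ?_
        (mul_left_cancel (FreeGroup.toWord_injective h1))
      rw [h1]; exact isPath_toWord_cover o p',
    fun ⟨w, hr, v, hw⟩ => by
      obtain ⟨p, W, h1, h2, h3⟩ := exists_lift hw
      refine ⟨p, Subtype.ext ?_⟩
      simp only [h3, inv_mul_cancel_left, FreeGroup.toWord_mk]
      exact hr.reduce_eq⟩

theorem reduced_path_cons_iff {u : V} {a : E × Bool} {w : List (E × Bool)} :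
    (FreeGroup.IsReduced (a :: w) ∧ ∃ v, G.IsPath u (a :: w) v) ↔
      G.initial a = u ∧ (a :: w).IsChain G.Follows := by
  rw [isChain_follows_iff]
  simp only [isPath_cons_iff]
  constructor
  · rintro ⟨h1, v, h2, h3, h4⟩; exact ⟨h2, h3, h1⟩
  · rintro ⟨h1, h2, h3⟩; exact ⟨h3, _, h1, h2, rfl⟩

open Classical in
/-- The number of vertices of the universal cover in an open ball. -/
noncomputable def vertexCount (G : MetricGraph V E) (v₀ : V) (o : CoverVertex G v₀) (T : ℝ) :
    ENNReal :=
  ∑' p : CoverVertex G v₀, if (G.universalCover v₀).vertexDist o p < T then 1 else 0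

-- Cover vertices are reduced paths starting at `o`: the empty path gives the first term, and the
-- others are sorted by their first edge into chains for `Follows`.
open Classical in
theorem vertexCount_eq [Fintype E] (o : CoverVertex G v₀) (T : ℝ) :
    vertexCount G v₀ o T = (if 0 < T then 1 else 0) +
      ∑ a with G.initial a = o.1.1,
        TransferOperator.chainCount G.Follows G.orientedLength a T := by
  simp only [vertexCount, vertexDist_universalCover]
  have h1 := (coverVertexEquiv o).tsum_eq
    fun w => if G.pathLength w.1 < T then (1 : ENNReal) else 0
  refine h1.trans ((tsum_subtype {w : List (E × Bool) |
    FreeGroup.IsReduced w ∧ ∃ v, G.IsPath o.1.1 w v}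
    (fun w => if G.pathLength w < T then (1 : ENNReal) else 0)).trans ?_)
  rw [TransferOperator.tsum_list_ennreal, Finset.sum_filter]
  refine congrArg₂ _ ?_ (Finset.sum_congr rfl fun a _ => ?_)
  · rw [Set.indicator_of_mem]
    · simp [pathLength]
    · exact ⟨FreeGroup.IsReduced.nil, _, rfl⟩
  · simp only [Set.indicator_apply, Set.mem_ofPred_eq, reduced_path_cons_iff]
    split_ifs with ha
    · refine tsum_congr fun w => ?_
      simp only [ha, true_and, ← ite_and]
      rfl
    · simp [ha]

end

end MetricGraph

/-! ### Irreducibility, phases along geodesics, and volume entropy -/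

namespace MetricGraph

section

variable {V E : Type*} {G : MetricGraph V E}

open Classical in
theorem degree_eq_card [Fintype E] (v : V) :
    G.degree v = (Finset.univ.filter fun a => G.initial a = v).card := by
  rw [degree, Nat.card_eq_fintype_card, Fintype.card_subtype]

/-- In a graph of minimal degree at least three every nonempty set of oriented edges which is closed
under continuation without backtracking is the whole edge set. -/
theorem mem_of_follows_closed [Fintype V] [Fintype E] (hconn : G.Connected)
    (hdeg : ∀ v, 3 ≤ G.degree v) (R : Finset (E × Bool)) (hR : R.Nonempty)
    (hcl : ∀ a ∈ R, ∀ b, G.Follows a b → b ∈ R) (b : E × Bool) : b ∈ R := by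
  classical
  -- If two edges of R end at x, the reverse of each edge of R ending there follows one of the two,
  -- so reversal injects. If only one ends at x, at least two other edges start there and lie in R.
  have hle : ∀ x, (R.filter fun a => G.terminal a = x).card ≤
      (R.filter fun a => G.initial a = x).card := by
    intro x
    set I := R.filter fun a => G.terminal a = x
    have h3 := hdeg x
    rw [degree_eq_card] at h3
    rcases Nat.lt_or_ge 1 I.card with h2 | h1
    · obtain ⟨a₁, h1, a₂, h2, hne⟩ := Finset.one_lt_card.1 h2
      rw [Finset.mem_filter] at h1 h2
      refine Finset.card_le_card_of_injOn rev (fun a ha => ?_) fun a _ b _ hab => by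
        simpa using congrArg rev hab
      have ha : a ∈ R ∧ G.terminal a = x := by simpa [I] using ha
      simp only [Finset.coe_filter, Set.mem_ofPred_eq, initial_rev, ha.2, and_true]
      by_cases e : rev a = rev a₁
      · exact hcl a₂ h2.1 _ ⟨by simp [h2.2, ha.2], fun e' => hne (by
          simpa using congrArg rev (e.symm.trans e'))⟩
      · exact hcl a₁ h1.1 _ ⟨by simp [h1.2, ha.2], e⟩
    · rcases I.eq_empty_or_nonempty with h0 | ⟨a, ha⟩
      · simp [h0]
      · have ha' := Finset.mem_filter.1 ha
        have : (Finset.univ.filter fun b => G.initial b = x).erase (rev a) ⊆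
            R.filter fun a => G.initial a = x := by
          intro b hb
          simp only [Finset.mem_erase, Finset.mem_filter, Finset.mem_univ, true_and] at hb ⊢
          exact ⟨hcl a ha'.1 b ⟨by rw [ha'.2, hb.2], hb.1⟩, hb.2⟩
        have h4 := (Finset.pred_card_le_card_erase).trans (Finset.card_le_card this)
        omega
  -- Both sides count R, so the vertexwise inequality is an equality everywhere.
  have hsum : ∑ x, (R.filter fun a => G.terminal a = x).card =
      ∑ x, (R.filter fun a => G.initial a = x).card := by
    rw [← Finset.card_eq_sum_card_fiberwise (f := G.terminal) (t := Finset.univ) (by simp),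
      ← Finset.card_eq_sum_card_fiberwise (f := G.initial) (t := Finset.univ) (by simp)]
  have heq := (Finset.sum_eq_sum_iff_of_le fun x _ => hle x).1 hsum
  -- R is closed even under backtracking: were `rev a` missing, `a` would be the only edge of R
  -- ending at its terminal vertex, while at least two start there. Connectedness then reaches every
  -- edge.
  have hall : ∀ a ∈ R, ∀ b, G.initial b = G.terminal a → b ∈ R := by
    intro a ha b hb
    by_contra hbR
    have hba : b = rev a := by
      by_contra hne
      exact hbR (hcl a ha b ⟨hb.symm, hne⟩)
    have hI : (R.filter fun a' => G.terminal a' = G.terminal a) = {a} := by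
      ext a'
      simp only [Finset.mem_filter, Finset.mem_singleton]
      constructor
      · rintro ⟨h1, h2⟩
        by_contra hne
        refine hbR (hcl a' h1 b ⟨by rw [h2, hb], fun e => hne ?_⟩)
        simpa using congrArg rev (e.symm.trans hba)
      · rintro rfl; exact ⟨ha, rfl⟩
    have h1 := heq (G.terminal a) (Finset.mem_univ _)
    rw [hI, Finset.card_singleton] at h1
    have h3 := hdeg (G.terminal a)
    rw [degree_eq_card] at h3
    have : (Finset.univ.filter fun b => G.initial b = G.terminal a).erase (rev a) ⊆
        R.filter fun a' => G.initial a' = G.terminal a := by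
      intro b hb
      simp only [Finset.mem_erase, Finset.mem_filter, Finset.mem_univ, true_and] at hb ⊢
      exact ⟨hcl a ha b ⟨hb.2.symm, hb.1⟩, hb.2⟩
    have h4 := (Finset.pred_card_le_card_erase).trans (Finset.card_le_card this)
    omega
  have key : ∀ w : List (E × Bool), ∀ x y, G.IsPath x w y →
      (∀ b, G.initial b = x → b ∈ R) → ∀ b, G.initial b = y → b ∈ R := by
    intro w
    induction w with
    | nil => intro x y h hx; cases h; exact hx
    | cons a w ih =>
      intro x y h hx
      exact ih _ _ h.2 fun b hb => hall a (hx a h.1) b hb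
  obtain ⟨a, ha⟩ := hR
  obtain ⟨w, hw⟩ := hconn (G.terminal a) (G.initial b)
  exact key w _ _ hw (fun b hb => hall a ha b hb) b rfl

theorem reflTransGen_follows [Fintype V] [Fintype E] (hconn : G.Connected)
    (hdeg : ∀ v, 3 ≤ G.degree v) (a b : E × Bool) : Relation.ReflTransGen G.Follows a b := by
  classical
  have := mem_of_follows_closed hconn hdeg
    (Finset.univ.filter fun b => Relation.ReflTransGen G.Follows a b)
    ⟨a, by simpa using Relation.ReflTransGen.refl⟩ (fun c hc d hcd => by
      simp only [Finset.mem_filter, Finset.mem_univ, true_and] at hc ⊢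
      exact hc.tail hcd) b
  simpa using this

theorem exists_follows_pair [Fintype E] (hdeg : ∀ v, 3 ≤ G.degree v) (a : E × Bool) :
    ∃ b c, b ≠ c ∧ G.Follows a b ∧ G.Follows a c := by
  classical
  have h3 := hdeg (G.terminal a)
  rw [degree_eq_card] at h3
  have h4 := Finset.pred_card_le_card_erase (a := rev a)
    (s := Finset.univ.filter fun b => G.initial b = G.terminal a)
  obtain ⟨b, hb, c, hc, hne⟩ := Finset.one_lt_card.1 (by omega :
    1 < ((Finset.univ.filter fun b => G.initial b = G.terminal a).erase (rev a)).card)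
  simp only [Finset.mem_erase, Finset.mem_filter, Finset.mem_univ, true_and] at hb hc
  exact ⟨b, c, hne, ⟨hb.2.symm, hb.1⟩, ⟨hc.2.symm, hc.1⟩⟩

/-- Reversing orientations turns a Perron function into one for the reversed relation. -/
theorem transfer_flip_follows [Fintype E] {h : ℝ} {v : E × Bool → ℝ}
    (hT : ∀ a, TransferOperator.transfer G.Follows G.orientedLength h v a = v a) (a : E × Bool) :
    TransferOperator.transfer (fun a b => G.Follows b a) G.orientedLength h (fun a => v (rev a)) a =
      v (rev a) := by
  classical
  rw [← hT (rev a), TransferOperator.transfer, TransferOperator.transfer]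
  refine congrArg₂ _ rfl (Finset.sum_nbij' rev rev ?_ ?_ ?_ ?_ ?_)
  · intro b hb
    simpa using (show G.Follows b a by simpa using hb).symm_rev
  · intro b hb
    simpa using (show G.Follows (rev a) b by simpa using hb).symm_rev
  · intro b _; simp
  · intro b _; simp
  · intro b _; simp

theorem phase_along_chain {θ : E × Bool → ℂ} {t : ℝ}
    (hθ : ∀ a b, G.Follows a b →
      θ b = Complex.exp (t * Complex.I * G.orientedLength a) * θ a)
    (a : E × Bool) (w : List (E × Bool)) (h : (a :: w).IsChain G.Follows) (b : E × Bool)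
    (hb : G.Follows ((a :: w).getLast (by simp)) b) :
    θ b = Complex.exp (t * Complex.I * (G.pathLength (a :: w) : ℝ)) * θ a := by
  induction w generalizing a with
  | nil => simpa [pathLength, orientedLength] using hθ a b hb
  | cons c w ih =>
    rw [List.isChain_cons_cons] at h
    rw [ih c h.2 (by simpa using hb), hθ a c h.1, ← mul_assoc, ← Complex.exp_add, pathLength_cons,
      pathLength_cons, pathLength_cons]
    congr 2
    simp only [orientedLength]
    push_cast; ring

/-- If the lengths of closed geodesics do not lie in a discrete subgroup, there is no nontrivial
phase function on the oriented edges. -/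
theorem no_phase (hlen : ¬ ∃ H : AddSubgroup ℝ,
      DiscreteTopology H ∧ G.closedGeodesicLengths ⊆ (H : Set ℝ))
    (t : ℝ) (ht : t ≠ 0) (θ : E × Bool → ℂ) (hθ1 : ∀ a, ‖θ a‖ = 1) :
    ¬ ∀ a b, G.Follows a b →
      θ b = Complex.exp (t * Complex.I * G.orientedLength a) * θ a := by
  intro hθ
  -- Once around a closed geodesic the phase is multiplied by e^{it·length}, which must be 1; so
  -- every length lies in (2π/t)ℤ.
  refine hlen ⟨AddSubgroup.zmultiples (2 * Real.pi / t), inferInstance, ?_⟩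
  rintro _ ⟨w, ⟨⟨v, hv⟩, hred, hne, hlast⟩, rfl⟩
  obtain ⟨a, w, rfl⟩ := List.exists_cons_of_ne_nil hne
  obtain ⟨h1, h2, h3⟩ := isPath_cons_iff.1 hv
  have hchain : (a :: w).IsChain G.Follows := by
    rw [isChain_follows_iff]
    refine ⟨h2, hred.imp fun a b hab => ne_rev_iff.1 hab⟩
  have hfol : G.Follows ((a :: w).getLast (by simp)) a := by
    refine ⟨h3.trans h1.symm, fun e => hlast ?_⟩
    conv_rhs => rw [List.head_cons, e]
    simp
  have h4 := phase_along_chain hθ a w hchain a hfol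
  have hθa : θ a ≠ 0 := by
    intro h0; have := hθ1 a; simp [h0] at this
  have h5 : Complex.exp (t * Complex.I * (G.pathLength (a :: w) : ℝ)) = 1 :=
    mul_right_cancel₀ hθa (by rw [one_mul]; exact h4.symm)
  obtain ⟨n, hn⟩ := Complex.exp_eq_one_iff.1 h5
  have h6 := congrArg Complex.im hn
  simp at h6
  refine AddSubgroup.mem_zmultiples_iff.2 ⟨n, ?_⟩
  rw [zsmul_eq_mul]
  field_simp
  linarith

variable {v₀ : V}

/-- Choosing such an end for each vertex injects the vertices into two copies of the edge set, which
bounds their number by volume in `le_tsum_edgeVolume`. -/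
theorem exists_incident_coverEdge [Fintype E] (hdeg : ∀ v, 3 ≤ G.degree v)
    (p : CoverVertex G v₀) : ∃ x : CoverEdge G v₀ ⊕ CoverEdge G v₀,
      Sum.elim (G.universalCover v₀).src (G.universalCover v₀).tgt x = p := by
  classical
  have h3 := hdeg p.1.1
  rw [degree_eq_card] at h3
  obtain ⟨⟨e, b⟩, ha⟩ := Finset.card_pos.1 (by omega :
    0 < (Finset.univ.filter fun a => G.initial a = p.1.1).card)
  obtain ⟨q, -, hq, -⟩ := exists_coverEdge (by simpa using ha)
  rcases b with _ | _
  · exact ⟨Sum.inr q, hq⟩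
  · exact ⟨Sum.inl q, hq⟩

/-- The volume of the part of a cover edge in a ball. -/
noncomputable def edgeVolume (G : MetricGraph V E) (o : V) (T : ℝ) (e : E) : ENNReal :=
  volume {t : ℝ | t ∈ Set.Icc 0 (G.length e) ∧ G.pointDist o e t < T}

open Classical in
theorem edgeVolume_le (o : V) (T : ℝ) (e : E) : G.edgeVolume o T e ≤
    ENNReal.ofReal (G.length e) * ((if G.vertexDist o (G.src e) < T then 1 else 0) +
      (if G.vertexDist o (G.tgt e) < T then 1 else 0)) := by
  have h1 : G.edgeVolume o T e ≤ ENNReal.ofReal (G.length e) := by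
    refine (measure_mono fun t ht => ht.1).trans ?_
    simp
  by_cases hs : G.vertexDist o (G.src e) < T
  · rw [if_pos hs]
    refine h1.trans (le_mul_of_one_le_right' le_self_add)
  by_cases ht : G.vertexDist o (G.tgt e) < T
  · rw [if_pos ht]
    refine h1.trans (le_mul_of_one_le_right' le_add_self)
  have : {t : ℝ | t ∈ Set.Icc 0 (G.length e) ∧ G.pointDist o e t < T} = ∅ := by
    ext t
    simp only [pointDist, Set.mem_Icc, min_lt_iff, Set.mem_ofPred_eq, Set.mem_empty_iff_false,
      iff_false, not_and, and_imp]
    intro h0 h1 h2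
    rcases h2 with h2 | h2 <;> linarith
  rw [edgeVolume, this]
  simp

theorem le_edgeVolume {o : V} {T L : ℝ} {e : E} (hL : G.length e < L)
    (h : G.vertexDist o (G.src e) < T ∨ G.vertexDist o (G.tgt e) < T) :
    ENNReal.ofReal (G.length e) ≤ G.edgeVolume o (T + L) e := by
  have : Set.Icc 0 (G.length e) ⊆
      {t : ℝ | t ∈ Set.Icc 0 (G.length e) ∧ G.pointDist o e t < T + L} := by
    intro t ht
    refine ⟨ht, ?_⟩
    rw [pointDist, min_lt_iff]
    rcases h with h | h
    · left; linarith [ht.2]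
    · right; linarith [ht.1]
  refine le_trans ?_ (measure_mono this)
  simp

/-- An edge meeting the ball has an end in it and is charged to that end. A cover edge is determined
by its label together with either its source or its target, so each vertex is charged at most 2|E|
times. -/
theorem tsum_edgeVolume_le [Fintype E] {L : ℝ} (hL : ∀ e, G.length e ≤ L) (o : CoverVertex G v₀)
    (T : ℝ) : ∑' q, (G.universalCover v₀).edgeVolume o T q ≤
      ENNReal.ofReal L * (2 * Fintype.card E) * G.vertexCount v₀ o T := by
  classical
  set f : CoverVertex G v₀ → ENNReal := fun p =>
    if (G.universalCover v₀).vertexDist o p < T then 1 else 0 with hf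
  have hprod : ∑' x : CoverVertex G v₀ × E, f x.1 = Fintype.card E * G.vertexCount v₀ o T := by
    rw [ENNReal.tsum_prod', vertexCount, ← ENNReal.tsum_mul_left]
    refine tsum_congr fun p => ?_
    simp [hf, Finset.card_univ]
  have hs : ∑' q : CoverEdge G v₀, f ((G.universalCover v₀).src q) ≤
      Fintype.card E * G.vertexCount v₀ o T := by
    rw [← hprod]
    exact ENNReal.tsum_comp_le_tsum_of_injective
      (f := fun q : CoverEdge G v₀ => (q.1 : CoverVertex G v₀ × E)) Subtype.val_injective
      (fun x => f x.1)
  have ht : ∑' q : CoverEdge G v₀, f ((G.universalCover v₀).tgt q) ≤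
      Fintype.card E * G.vertexCount v₀ o T := by
    rw [← hprod]
    refine ENNReal.tsum_comp_le_tsum_of_injective
      (f := fun q : CoverEdge G v₀ => ((G.universalCover v₀).tgt q, q.1.2)) ?_
      (fun x => f x.1)
    intro q q' h
    simp only [Prod.mk.injEq] at h
    have h1 : q.1.1.1.2 * FreeGroup.of q.1.2 = q'.1.1.1.2 * FreeGroup.of q'.1.2 :=
      congrArg (fun p : CoverVertex G v₀ => p.1.2) h.1
    rw [h.2] at h1
    refine Subtype.ext (Prod.ext (Subtype.ext (Prod.ext ?_ (mul_right_cancel h1))) h.2)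
    rw [q.2, q'.2, h.2]
  calc ∑' q, (G.universalCover v₀).edgeVolume o T q
      ≤ ∑' q, ENNReal.ofReal L * (f ((G.universalCover v₀).src q) +
          f ((G.universalCover v₀).tgt q)) := by
        refine ENNReal.tsum_le_tsum fun q => (edgeVolume_le o T q).trans ?_
        exact mul_le_mul_left (ENNReal.ofReal_le_ofReal (hL q.1.2)) _
    _ = ENNReal.ofReal L * (∑' q, f ((G.universalCover v₀).src q) +
          ∑' q, f ((G.universalCover v₀).tgt q)) := by
        rw [ENNReal.tsum_mul_left, ENNReal.tsum_add]
    _ ≤ ENNReal.ofReal L * (Fintype.card E * G.vertexCount v₀ o T +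
          Fintype.card E * G.vertexCount v₀ o T) := by gcongr
    _ = _ := by ring

/-- An edge with an end within distance T lies wholly in the ball of radius T + L, and it is chosen
by at most its two ends. -/
theorem le_tsum_edgeVolume [Fintype E] (hdeg : ∀ v, 3 ≤ G.degree v) {L m : ℝ}
    (hL : ∀ e, G.length e < L) (hm : ∀ e, m ≤ G.length e) (o : CoverVertex G v₀) (T : ℝ) :
    ENNReal.ofReal m * G.vertexCount v₀ o T ≤
      2 * ∑' q, (G.universalCover v₀).edgeVolume o (T + L) q := by
  classical
  choose i hi using exists_incident_coverEdge (v₀ := v₀) hdeg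
  have hinj : Function.Injective i := Function.LeftInverse.injective hi
  set g := fun q => (G.universalCover v₀).edgeVolume o (T + L) q
  calc ENNReal.ofReal m * G.vertexCount v₀ o T
      ≤ ∑' p, Sum.elim g g (i p) := by
        rw [vertexCount, ← ENNReal.tsum_mul_left]
        refine ENNReal.tsum_le_tsum fun p => ?_
        split_ifs with hp
        · have h1 := hi p
          rw [mul_one]
          rcases hx : i p with q | q
          · rw [hx] at h1
            exact (ENNReal.ofReal_le_ofReal (hm q.1.2)).trans (le_edgeVolume (hL q.1.2)
              (Or.inl (by rw [show (G.universalCover v₀).src q = p from h1]; exact hp)))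
          · rw [hx] at h1
            exact (ENNReal.ofReal_le_ofReal (hm q.1.2)).trans (le_edgeVolume (hL q.1.2)
              (Or.inr (by rw [show (G.universalCover v₀).tgt q = p from h1]; exact hp)))
        · simp
    _ ≤ ∑' x, Sum.elim g g x := ENNReal.tsum_comp_le_tsum_of_injective hinj _
    _ = ∑' q, g q + ∑' q, g q := by
        rw [Summable.tsum_sum ENNReal.summable ENNReal.summable]; rfl
    _ = _ := by ring

end

/-- A function squeezed between multiples of `exp (h T)` has exponential growth rate `h`. -/
theorem tendsto_log_of_exp_bounds {f : ℝ → ℝ} {h c C : ℝ} (hc : 0 < c)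
    (hb : ∀ᶠ T in atTop, c * Real.exp (h * T) ≤ f T ∧ f T ≤ C * Real.exp (h * T)) :
    Tendsto (fun T => 1 / T * Real.log (f T)) atTop (𝓝 h) := by
  have lim : ∀ k : ℝ, Tendsto (fun T : ℝ => Real.log k / T + h) atTop (𝓝 h) := by
    intro k
    simpa using (tendsto_const_nhds.div_atTop tendsto_id).add_const h
  have hlog : ∀ k : ℝ, 0 < k → ∀ T : ℝ, 0 < T →
      1 / T * Real.log (k * Real.exp (h * T)) = Real.log k / T + h := by
    intro k hk T hT
    rw [Real.log_mul hk.ne' (Real.exp_pos _).ne', Real.log_exp]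
    field_simp
  refine tendsto_of_tendsto_of_tendsto_of_le_of_le' (lim c) (lim C) ?_ ?_
  · filter_upwards [hb, eventually_gt_atTop 0] with T hT h0
    rw [← hlog c hc T h0]
    exact mul_le_mul_of_nonneg_left (Real.log_le_log (by positivity) hT.1) (by positivity)
  · filter_upwards [hb, eventually_gt_atTop 0] with T hT h0
    have hf : 0 < f T := lt_of_lt_of_le (by positivity) hT.1
    have hC : 0 < C := by
      by_contra hneg
      have := mul_nonpos_of_nonpos_of_nonneg (not_lt.1 hneg) (Real.exp_pos (h * T)).le
      linarith [hT.2]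
    rw [← hlog C hC T h0]
    exact mul_le_mul_of_nonneg_left (Real.log_le_log hf hT.2) (by positivity)

section

variable {V E : Type*} {G : MetricGraph V E} {v₀ : V}

/-- The Perron exponent is the volume entropy of the universal cover. -/
theorem tendsto_log_ballVolume [Fintype E] [Nonempty E] (hdeg : ∀ v, 3 ≤ G.degree v) {h : ℝ}
    (hh : 0 < h) {v : E × Bool → ℝ} (hv : ∀ a, 0 < v a)
    (hT : ∀ a, TransferOperator.transfer G.Follows G.orientedLength h v a = v a)
    (o : CoverVertex G v₀) :
    Tendsto (fun T : ℝ => 1 / T * Real.log ((G.universalCover v₀).ballVolume o T))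
      atTop (𝓝 h) := by
  classical
  obtain ⟨C, hC, hup⟩ := TransferOperator.exists_chainCount_le G.orientedLength_pos
    (exists_follows_pair hdeg) hh hv hT
  obtain ⟨c, hc, hlow⟩ := TransferOperator.exists_le_chainCount G.orientedLength_pos hh hv hT
  obtain ⟨e₁, he₁⟩ := Finite.exists_max G.length
  obtain ⟨e₂, he₂⟩ := Finite.exists_min G.length
  set L := G.length e₁ + 1 with hL
  have hLpos : 0 < L := by have := G.length_pos e₁; linarith
  have hlowV : ∀ T, 0 < T → ENNReal.ofReal (c * Real.exp (h * T)) ≤ G.vertexCount v₀ o T := by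
    intro T h0
    have h3 := hdeg o.1.1
    rw [degree_eq_card] at h3
    obtain ⟨a, ha⟩ := Finset.card_pos.1 (by omega :
      0 < (Finset.univ.filter fun a => G.initial a = o.1.1).card)
    rw [vertexCount_eq, if_pos h0]
    -- The `+ 1` of the lower bound is matched by the empty path, which is counted because T > 0.
    refine (hlow a T).trans ?_
    rw [add_comm]
    gcongr
    exact Finset.single_le_sum
      (f := fun a => TransferOperator.chainCount G.Follows G.orientedLength a T)
      (fun _ _ => zero_le) ha
  have hupV : ∀ T, 0 < T → G.vertexCount v₀ o T ≤
      ENNReal.ofReal ((1 + Fintype.card (E × Bool) * C) * Real.exp (h * T)) := by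
    intro T h0
    rw [vertexCount_eq, if_pos h0, add_mul, ENNReal.ofReal_add (by positivity) (by positivity)]
    gcongr
    · rw [one_mul, ← ENNReal.ofReal_one]
      exact ENNReal.ofReal_le_ofReal (Real.one_le_exp (by positivity))
    · refine (Finset.sum_le_sum_of_subset (Finset.filter_subset _ _)).trans ?_
      refine (Finset.sum_le_sum fun a _ => hup a T h0.le).trans ?_
      rw [Finset.sum_const, nsmul_eq_mul, Finset.card_univ, mul_assoc,
        ENNReal.ofReal_mul (Nat.cast_nonneg _), ENNReal.ofReal_natCast]
  have hvolup : ∀ T, 0 < T → ∑' q, (G.universalCover v₀).edgeVolume o T q ≤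
      ENNReal.ofReal (L * (2 * Fintype.card E) *
        ((1 + Fintype.card (E × Bool) * C) * Real.exp (h * T))) := by
    intro T h0
    refine (tsum_edgeVolume_le (L := L) (fun e => by linarith [he₁ e]) o T).trans ?_
    rw [ENNReal.ofReal_mul (by positivity), ENNReal.ofReal_mul hLpos.le,
      ENNReal.ofReal_mul zero_le_two, ENNReal.ofReal_natCast, ENNReal.ofReal_ofNat]
    gcongr
    exact hupV T h0
  refine tendsto_log_of_exp_bounds (c := G.length e₂ * c * Real.exp (-h * L) / 2)
    (C := L * (2 * Fintype.card E) * (1 + Fintype.card (E × Bool) * C)) ?_ ?_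
  · have := G.length_pos e₂
    positivity
  filter_upwards [eventually_gt_atTop L] with T hTL
  have hT0 : 0 < T := hLpos.trans hTL
  have hfin : ∑' q, (G.universalCover v₀).edgeVolume o T q ≠ ⊤ :=
    ne_top_of_le_ne_top ENNReal.ofReal_ne_top (hvolup T hT0)
  change _ ≤ (∑' q, (G.universalCover v₀).edgeVolume o T q).toReal ∧
    (∑' q, (G.universalCover v₀).edgeVolume o T q).toReal ≤ _
  constructor
  · have h1 := le_tsum_edgeVolume (v₀ := v₀) hdeg (L := L) (m := G.length e₂)
      (fun e => by linarith [he₁ e]) he₂ o (T - L)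
    rw [sub_add_cancel] at h1
    have h2 := (mul_le_mul_right (hlowV (T - L) (by linarith))
      (ENNReal.ofReal (G.length e₂))).trans h1
    rw [← ENNReal.ofReal_mul (G.length_pos e₂).le] at h2
    have h3 := ENNReal.toReal_mono (ENNReal.mul_ne_top (by simp) hfin) h2
    have hpos : 0 ≤ G.length e₂ * (c * Real.exp (h * (T - L))) := by
      have := (G.length_pos e₂).le
      positivity
    rw [ENNReal.toReal_ofReal hpos, ENNReal.toReal_mul, ENNReal.toReal_ofNat] at h3
    have h4 : Real.exp (h * (T - L)) = Real.exp (-h * L) * Real.exp (h * T) := by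
      rw [← Real.exp_add]; ring_nf
    rw [h4] at h3
    linarith
  · refine ENNReal.toReal_le_of_le_ofReal (by positivity) ?_
    rw [mul_assoc]
    exact hvolup T hT0

end

end MetricGraph

/-! ### Cyclic reduction of conjugates in free groups -/

namespace FreeGroup

variable {α : Type*}

theorem IsReduced.invRev {w : List (α × Bool)} (h : IsReduced w) : IsReduced (invRev w) := by
  classical
  rw [isReduced_iff_reduce_eq, reduce_invRev, h.reduce_eq]

theorem invRev_cons_eq (a : α × Bool) (w : List (α × Bool)) :
    invRev (a :: w) = invRev w ++ [MetricGraph.rev a] := by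
  simp [invRev, MetricGraph.rev]

theorem mk_conj (w c : List (α × Bool)) :
    mk (w ++ c ++ invRev w) = mk w * mk c * (mk w)⁻¹ := by
  rw [← mul_mk, ← mul_mk, ← inv_mk]

theorem IsCyclicallyReduced.reduceCyclically_eq [DecidableEq α] {c : List (α × Bool)}
    (hc : IsCyclicallyReduced c) : reduceCyclically c = c := by
  induction c using List.bidirectionalRec
  case nil => simp
  case singleton => simp
  case cons_append a l b _ =>
    rw [reduceCyclically.cons_append, if_neg]
    · simp
    · rintro ⟨h1, h2⟩
      have := (isCyclicallyReduced_cons_append_iff.1 hc).2 h1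
      rw [this] at h2
      simp at h2

theorem reduceCyclically_conj [DecidableEq α] {c : List (α × Bool)}
    (hc : IsCyclicallyReduced c) (w : List (α × Bool)) :
    reduceCyclically (w ++ c ++ invRev w) = c := by
  induction w with
  | nil => simpa using hc.reduceCyclically_eq
  | cons a w ih =>
    have : a :: w ++ c ++ invRev (a :: w) = a :: ((w ++ c ++ invRev w) ++ [MetricGraph.rev a]) := by
      rw [invRev_cons_eq]; simp
    rw [this, reduceCyclically.cons_append, if_pos, ih]
    simp [MetricGraph.rev]

/-- Since the core is already known to be `c`, comparing total lengths forces the two conjugators to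
have equal length, hence to be the same prefix. -/
theorem conjugator_conj [DecidableEq α] {c : List (α × Bool)}
    (hc : IsCyclicallyReduced c) (w : List (α × Bool)) :
    reduceCyclically.conjugator (w ++ c ++ invRev w) = w := by
  have h := reduceCyclically.conj_conjugator_reduceCyclically (w ++ c ++ invRev w)
  rw [reduceCyclically_conj hc] at h
  have hl := congrArg List.length h
  simp only [List.length_append, invRev_length] at hl
  rw [List.append_assoc, List.append_assoc w] at h
  rw [List.append_assoc]
  rw [List.append_assoc w] at hl
  exact List.append_inj_left h (by omega)

/-- Conjugate cyclically reduced words have the same length. -/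
theorem length_le_of_isConj {c c' : List (α × Bool)} (hc : IsCyclicallyReduced c)
    {t : FreeGroup α} (h : mk c = t * mk c' * t⁻¹) : c.length ≤ c'.length := by
  classical
  by_contra! hlt
  -- The n-th power of the cyclically reduced word has norm n|c|, while conjugation adds at most
  -- 2|t| to n|c'|. With n > 2|t| even one extra letter in c is impossible.
  set n := 2 * norm t + 1
  have h1 : norm (mk c ^ n) = n * c.length := by
    rw [pow_mk, norm, toWord_mk, (hc.flatten_replicate n).isReduced.reduce_eq]
    simp
  have h2 : norm (mk c ^ n) ≤ norm t + n * c'.length + norm t := by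
    rw [h, conj_pow]
    refine (norm_mul_le _ _).trans (add_le_add ((norm_mul_le _ _).trans
      (add_le_add le_rfl ?_)) norm_inv_eq.le)
    rw [pow_mk]
    exact norm_mk_le.trans (by simp)
  rw [h1] at h2
  have h3 : n * (c'.length + 1) ≤ n * c.length := Nat.mul_le_mul_left _ hlt
  have : n = 2 * norm t + 1 := rfl
  rw [mul_add] at h3
  omega

end FreeGroup

/-! ### Cores and conjugating paths of a conjugacy class -/

namespace MetricGraph

section

open FreeGroup

variable {V E : Type*} {G : MetricGraph V E} {v₀ : V}

theorem IsPath.start_unique {u u' v v' : V} {w : List (E × Bool)} (hw : w ≠ [])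
    (h : G.IsPath u w v) (h' : G.IsPath u' w v') : u = u' := by
  cases w with
  | nil => exact absurd rfl hw
  | cons a w => exact h.1.symm.trans h'.1

/-- The decompositions `w c w⁻¹` of the elements of a conjugacy class, moved to the vertex `o`, into
a conjugating path and a cyclically reduced core. -/
def conjPairs (o : CoverVertex G v₀) (C : ConjClasses (G.fundamentalGroup v₀)) :
    Set (List (E × Bool) × List (E × Bool)) :=
  {p | IsCyclicallyReduced p.1 ∧ IsReduced (p.2 ++ p.1 ++ invRev p.2) ∧
    ∃ x ∈ C.carrier, o.1.2⁻¹ * ((x : FreeGroup E) * o.1.2) = FreeGroup.mk (p.2 ++ p.1 ++ invRev p.2)}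

/-- The cyclically reduced cores of a conjugacy class. -/
def conjCores (o : CoverVertex G v₀) (C : ConjClasses (G.fundamentalGroup v₀)) :
    Set (List (E × Bool)) :=
  {c | ∃ w, (c, w) ∈ conjPairs o C}

theorem displacement_eq [DecidableEq E] (o : CoverVertex G v₀) (x : G.fundamentalGroup v₀) :
    G.displacement v₀ o x = G.pathLength (o.1.2⁻¹ * ((x : FreeGroup E) * o.1.2)).toWord :=
  vertexDist_universalCover o (x • o)

theorem isPath_conj [DecidableEq E] (o : CoverVertex G v₀) (x : G.fundamentalGroup v₀) :
    G.IsPath o.1.1 (o.1.2⁻¹ * ((x : FreeGroup E) * o.1.2)).toWord o.1.1 :=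
  isPath_toWord_cover o (x • o)

/-- The elements of a conjugacy class correspond to their decompositions. -/
noncomputable def conjEquiv [DecidableEq E] (o : CoverVertex G v₀)
    (C : ConjClasses (G.fundamentalGroup v₀)) : C.carrier ≃ conjPairs o C :=
  Equiv.ofBijective
    (fun x => ⟨(reduceCyclically (o.1.2⁻¹ * ((x.1 : FreeGroup E) * o.1.2)).toWord,
      reduceCyclically.conjugator (o.1.2⁻¹ * ((x.1 : FreeGroup E) * o.1.2)).toWord),
      reduceCyclically.isCyclicallyReduced isReduced_toWord, by
        simp only [reduceCyclically.conj_conjugator_reduceCyclically]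
        exact ⟨isReduced_toWord, x.1, x.2, mk_toWord.symm⟩⟩)
    ⟨fun x y h => by
      have h1 := congrArg Subtype.val h
      simp only [Prod.mk.injEq] at h1
      have h2 := reduceCyclically.conj_conjugator_reduceCyclically
        (o.1.2⁻¹ * ((x.1 : FreeGroup E) * o.1.2)).toWord
      rw [h1.1, h1.2, reduceCyclically.conj_conjugator_reduceCyclically] at h2
      have h3 := mul_right_cancel (mul_left_cancel (toWord_injective h2))
      exact Subtype.ext (Subtype.ext h3.symm),
    fun ⟨⟨c, w⟩, hc, hr, x, hx, h⟩ => by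
      refine ⟨⟨x, hx⟩, Subtype.ext ?_⟩
      simp only [h, toWord_mk, hr.reduce_eq, reduceCyclically_conj hc, conjugator_conj hc]⟩

theorem displacement_eq_of_conjEquiv [DecidableEq E] (o : CoverVertex G v₀)
    (C : ConjClasses (G.fundamentalGroup v₀)) (x : C.carrier) :
    G.displacement v₀ o x = G.pathLength (conjEquiv o C x).1.1 +
      2 * G.pathLength (conjEquiv o C x).1.2 := by
  rw [displacement_eq, ← reduceCyclically.conj_conjugator_reduceCyclically
    (o.1.2⁻¹ * ((x.1 : FreeGroup E) * o.1.2)).toWord, pathLength_append, pathLength_append,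
    pathLength_invRev]
  change _ = G.pathLength (reduceCyclically (o.1.2⁻¹ * ((x.1 : FreeGroup E) * o.1.2)).toWord) +
    2 * G.pathLength (reduceCyclically.conjugator (o.1.2⁻¹ * ((x.1 : FreeGroup E) * o.1.2)).toWord)
  ring

theorem ne_nil_of_mem_conjPairs {o : CoverVertex G v₀} {C : ConjClasses (G.fundamentalGroup v₀)}
    (hC : C ≠ ConjClasses.mk 1) {c w : List (E × Bool)} (h : (c, w) ∈ conjPairs o C) : c ≠ [] := by
  rintro rfl
  obtain ⟨-, -, x, hx, h⟩ := h
  rw [mk_conj, ← one_eq_mk, mul_one, mul_inv_cancel] at h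
  have h1 : (x : FreeGroup E) = 1 := by
    have := congrArg (fun z => o.1.2 * z * o.1.2⁻¹) h
    simpa [mul_assoc] using this
  refine hC ?_
  rw [← ConjClasses.mem_carrier_iff_mk_eq.1 hx, show x = 1 from Subtype.ext h1]

theorem exists_path_of_mem_conjPairs {o : CoverVertex G v₀}
    {C : ConjClasses (G.fundamentalGroup v₀)} {c w : List (E × Bool)}
    (h : (c, w) ∈ conjPairs o C) : ∃ u, G.IsPath o.1.1 w u ∧ G.IsPath u c u := by
  classical
  obtain ⟨-, hr, x, hx, h⟩ := h
  have h1 := isPath_conj o x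
  rw [h, toWord_mk, hr.reduce_eq, isPath_append_iff] at h1
  obtain ⟨u, h1, h2⟩ := h1
  obtain ⟨u', h1, h3⟩ := isPath_append_iff.1 h1
  have h4 := isPath_invRev G h2
  rw [invRev_invRev] at h4
  exact ⟨u, h4, by rwa [h1.unique h4] at h3⟩

/-- A core may be conjugated by any path ending at its base point. -/
theorem mem_conjPairs_iff {o : CoverVertex G v₀} {C : ConjClasses (G.fundamentalGroup v₀)}
    (hC : C ≠ ConjClasses.mk 1) {c w : List (E × Bool)} (hc : c ∈ conjCores o C) :
    (c, w) ∈ conjPairs o C ↔ IsReduced (w ++ c ++ invRev w) ∧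
      ∃ u, G.IsPath o.1.1 w u ∧ G.IsPath u c u := by
  refine ⟨fun h => ⟨h.2.1, exists_path_of_mem_conjPairs h⟩, fun ⟨hr, u, hw, hcu⟩ => ?_⟩
  obtain ⟨w', h⟩ := hc
  obtain ⟨u', hw', hcu'⟩ := exists_path_of_mem_conjPairs h
  obtain rfl := hcu.start_unique (ne_nil_of_mem_conjPairs hC h) hcu'
  obtain ⟨hcyc, -, x, hx, hxe⟩ := h
  refine ⟨hcyc, hr, ?_⟩
  obtain ⟨z, hz, hzo⟩ := o.2
  -- The conjugating loop runs to `o`, out along `w`, back along `w'`, and returns to the base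
  -- point; conjugating `x` by it replaces `w'` by `w` around the same core.
  have hk : o.1.2 * (FreeGroup.mk w * (FreeGroup.mk w')⁻¹) * o.1.2⁻¹ ∈ G.fundamentalGroup v₀ :=
    ⟨z ++ (w ++ invRev w') ++ invRev z,
      G.isPath_append (G.isPath_append hz (G.isPath_append hw (G.isPath_invRev hw')))
        (G.isPath_invRev hz),
      by rw [← mul_mk, ← mul_mk, ← mul_mk, ← inv_mk, ← inv_mk, hzo]⟩
  set k : G.fundamentalGroup v₀ := ⟨_, hk⟩
  refine ⟨k * x * k⁻¹, ?_, ?_⟩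
  · rw [ConjClasses.mem_carrier_iff_mk_eq] at hx ⊢
    rw [← hx, ConjClasses.mk_eq_mk_iff_isConj]
    exact (isConj_iff.2 ⟨k, rfl⟩).symm
  · rw [mk_conj] at hxe ⊢
    have hx2 : (x : FreeGroup E) = o.1.2 * (FreeGroup.mk w' * FreeGroup.mk c * (FreeGroup.mk w')⁻¹) * o.1.2⁻¹ := by
      rw [← hxe]; group
    rw [Subgroup.coe_mul, Subgroup.coe_mul, Subgroup.coe_inv, hx2]
    simp only [k]
    group

theorem conjCores_nonempty (o : CoverVertex G v₀) (C : ConjClasses (G.fundamentalGroup v₀)) :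
    (conjCores o C).Nonempty := by
  classical
  obtain ⟨x, rfl⟩ := ConjClasses.mk_surjective C
  exact ⟨_, _, (conjEquiv o _ ⟨x, ConjClasses.mem_carrier_mk⟩).2⟩

/-- All cores are conjugate, so none is longer than a fixed one, and the alphabet is finite. -/
theorem conjCores_finite [Finite E] (o : CoverVertex G v₀)
    (C : ConjClasses (G.fundamentalGroup v₀)) : (conjCores o C).Finite := by
  obtain ⟨c₀, w₀, h₀⟩ := conjCores_nonempty o C
  refine (List.finite_length_le (E × Bool) c₀.length).subset ?_
  rintro c ⟨w, hcyc, -, x, hx, h⟩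
  obtain ⟨-, -, x₀, hx₀, h₀⟩ := h₀
  rw [ConjClasses.mem_carrier_iff_mk_eq] at hx hx₀
  obtain ⟨k, hk⟩ := isConj_iff.1 (ConjClasses.mk_eq_mk_iff_isConj.1 (hx₀.trans hx.symm))
  rw [mk_conj] at h h₀
  refine length_le_of_isConj (t := (FreeGroup.mk w)⁻¹ * (o.1.2⁻¹ * k * o.1.2) * FreeGroup.mk w₀) hcyc ?_
  have e1 : FreeGroup.mk c = (FreeGroup.mk w)⁻¹ * (o.1.2⁻¹ * ((x : FreeGroup E) * o.1.2)) * FreeGroup.mk w := by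
    rw [h]; group
  have e2 : FreeGroup.mk c₀ = (FreeGroup.mk w₀)⁻¹ * (o.1.2⁻¹ * ((x₀ : FreeGroup E) * o.1.2)) * FreeGroup.mk w₀ := by
    rw [h₀]; group
  rw [e1, e2, ← hk, Subgroup.coe_mul, Subgroup.coe_mul, Subgroup.coe_inv]
  group

/-- The condition on the last edge of a path for it to conjugate the core `c` without
cancellation. -/
def CanPrecede (G : MetricGraph V E) (c : List (E × Bool)) (b : E × Bool) : Prop :=
  IsReduced (b :: (c ++ [rev b])) ∧ G.IsPath (G.terminal b) c (G.terminal b)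

/-- Reducedness is a condition on adjacent letters, so beyond `a :: w` itself only its last edge
interacts with `c`. This is what makes admissible conjugators the paths counted by `pathWeight`. -/
theorem isReduced_conj_iff (c : List (E × Bool)) (a : E × Bool) (w : List (E × Bool)) :
    IsReduced (a :: w ++ c ++ invRev (a :: w)) ↔ IsReduced (a :: w) ∧
      IsReduced ((a :: w).getLast (by simp) :: (c ++ [rev ((a :: w).getLast (by simp))])) := by
  set b := (a :: w).getLast (by simp) with hb
  obtain ⟨z, hz⟩ : ∃ z, a :: w = z ++ [b] := ⟨_, (List.dropLast_append_getLast (by simp)).symm⟩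
  have hinv : invRev (a :: w) = rev b :: invRev z := by
    rw [hz, invRev_append]; simp [invRev, rev]
  constructor
  · intro h
    refine ⟨h.infix ⟨[], c ++ invRev (a :: w), by simp⟩, h.infix ⟨z, invRev z, ?_⟩⟩
    rw [hinv, hz]; simp
  · rintro ⟨h1, h2⟩
    have h3 := h1.invRev
    rw [hinv] at h3 ⊢
    rw [hz] at h1 ⊢
    have h4 : IsReduced (z ++ [b] ++ (c ++ [rev b])) := h1.append_overlap h2 (by simp)
    have h5 : IsReduced (z ++ [b] ++ c ++ [rev b] ++ invRev z) := by
      refine IsReduced.append_overlap (L₂ := [rev b]) ?_ h3 (by simp)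
      simpa using h4
    simpa using h5

theorem cons_mem_conjPairs_iff {o : CoverVertex G v₀} {C : ConjClasses (G.fundamentalGroup v₀)}
    (hC : C ≠ ConjClasses.mk 1) {c : List (E × Bool)} (hc : c ∈ conjCores o C)
    (a : E × Bool) (w : List (E × Bool)) :
    (c, a :: w) ∈ conjPairs o C ↔ G.initial a = o.1.1 ∧ (a :: w).IsChain G.Follows ∧
      CanPrecede G c ((a :: w).getLast (by simp)) := by
  rw [mem_conjPairs_iff hC hc, isReduced_conj_iff, isChain_follows_iff, CanPrecede]
  simp only [isPath_cons_iff]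
  constructor
  · rintro ⟨⟨h1, h2⟩, u, ⟨h3, h4, rfl⟩, h5⟩
    exact ⟨h3, ⟨h4, h1⟩, h2, h5⟩
  · rintro ⟨h3, ⟨h4, h1⟩, h2, h5⟩
    exact ⟨⟨h1, h2⟩, _, ⟨h3, h4, rfl⟩, h5⟩

/-- At the base point of the core, degree 3 leaves an outgoing edge other than the first edge of c
and the reverse of its last; its reverse may precede c. This supplies the nonzero source term in the
lower bound for the path series. -/
theorem exists_canPrecede [Fintype E] (hdeg : ∀ v, 3 ≤ G.degree v) {o : CoverVertex G v₀}
    {C : ConjClasses (G.fundamentalGroup v₀)} (hC : C ≠ ConjClasses.mk 1) {c : List (E × Bool)}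
    (hc : c ∈ conjCores o C) : ∃ b, CanPrecede G c b := by
  classical
  obtain ⟨w, hw⟩ := hc
  obtain ⟨u, -, hu⟩ := exists_path_of_mem_conjPairs hw
  have hne := ne_nil_of_mem_conjPairs hC hw
  have h3 := hdeg u
  rw [degree_eq_card] at h3
  have h4 := Finset.pred_card_le_card_erase (a := c.head hne)
    (s := Finset.univ.filter fun b => G.initial b = u)
  have h5 := Finset.pred_card_le_card_erase (a := rev (c.getLast hne))
    (s := (Finset.univ.filter fun b => G.initial b = u).erase (c.head hne))
  obtain ⟨a, ha⟩ := Finset.card_pos.1 (by omega : 0 < (((Finset.univ.filter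
    fun b => G.initial b = u).erase (c.head hne)).erase (rev (c.getLast hne))).card)
  simp only [Finset.mem_erase, Finset.mem_filter, Finset.mem_univ, true_and] at ha
  refine ⟨rev a, ?_, by simpa [ha.2.2] using hu⟩
  rw [rev_rev, FreeGroup.IsReduced, List.isChain_cons, List.isChain_append]
  refine ⟨fun y hy => ?_, hw.1.isReduced, List.isChain_singleton _, fun x hx y hy => ?_⟩
  · rw [List.head?_append_of_ne_nil _ hne, List.head?_eq_some_head hne] at hy
    cases hy
    exact ne_rev_iff.1 (by simpa using ha.2.1.symm)
  · rw [List.getLast?_eq_some_getLast hne] at hx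
    cases hx
    cases hy
    exact ne_rev_iff.1 ha.1

end

end MetricGraph

/-! ### Calculus of real pole bounds -/

/-- Near `z`, on the real axis to the right of `z`, the function is real and comparable with
`1 / (σ - z)`. -/
def RealPoleBounds (f : ℂ → ℂ) (z : ℝ) : Prop :=
  ∃ k > 0, ∃ K, ∀ᶠ σ : ℝ in 𝓝[>] z, ∃ u : ℝ, f σ = u ∧ k / (σ - z) ≤ u ∧ u ≤ K / (σ - z)

namespace RealPoleBounds

variable {f g : ℂ → ℂ} {z : ℝ}

/-- Positive lower constants add, which is what prevents poles from cancelling in the sum over cores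
and initial edges. -/
theorem add (hf : RealPoleBounds f z) (hg : RealPoleBounds g z) :
    RealPoleBounds (fun s => f s + g s) z := by
  obtain ⟨k, hk, K, hf⟩ := hf
  obtain ⟨k', hk', K', hg⟩ := hg
  refine ⟨k + k', add_pos hk hk', K + K', ?_⟩
  filter_upwards [hf, hg] with σ ⟨u, h1, h2, h3⟩ ⟨u', h1', h2', h3'⟩
  refine ⟨u + u', by rw [h1, h1']; push_cast; rfl, ?_, ?_⟩ <;> rw [add_div] <;> linarith

theorem sum {ι : Type*} {t : Finset ι} (ht : t.Nonempty) {f : ι → ℂ → ℂ}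
    (hf : ∀ i ∈ t, RealPoleBounds (f i) z) : RealPoleBounds (fun s => ∑ i ∈ t, f i s) z := by
  classical
  induction ht using Finset.Nonempty.cons_induction with
  | singleton i => simpa using hf i (by simp)
  | cons i t hi ht ih =>
    simp only [Finset.sum_cons]
    exact (hf i (by simp)).add (ih fun j hj => hf j (by simp [hj]))

theorem const_add {c : ℝ} (hc : 0 ≤ c) (hf : RealPoleBounds f z) :
    RealPoleBounds (fun s => c + f s) z := by
  obtain ⟨k, hk, K, hf⟩ := hf
  refine ⟨k, hk, c + K, ?_⟩
  filter_upwards [hf, Ioc_mem_nhdsGT (show z < z + 1 by linarith)] with σ ⟨u, h1, h2, h3⟩ ⟨h4, h5⟩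
  have hpos : 0 < σ - z := by linarith
  refine ⟨c + u, by rw [h1]; push_cast; rfl, by linarith, ?_⟩
  rw [add_div]
  have : c ≤ c / (σ - z) := le_div_self hc hpos (by linarith)
  linarith

theorem exp_mul {a : ℝ} (ha : 0 ≤ a) (hz : 0 ≤ z) (hf : RealPoleBounds f z) :
    RealPoleBounds (fun s => Complex.exp (-s * a) * f s) z := by
  obtain ⟨k, hk, K, hf⟩ := hf
  refine ⟨Real.exp (-(z + 1) * a) * k, by positivity, K, ?_⟩
  filter_upwards [hf, Ioc_mem_nhdsGT (show z < z + 1 by linarith)] with σ ⟨u, h1, h2, h3⟩ ⟨h4, h5⟩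
  have hpos : 0 < σ - z := by linarith
  have hu : 0 ≤ u := (div_nonneg hk.le hpos.le).trans h2
  refine ⟨Real.exp (-σ * a) * u, by rw [h1]; push_cast; rfl, ?_, ?_⟩
  · rw [mul_div_assoc]
    refine mul_le_mul (Real.exp_le_exp.2 ?_) h2 (div_nonneg hk.le hpos.le) (Real.exp_pos _).le
    nlinarith
  · refine le_trans (mul_le_of_le_one_left hu (Real.exp_le_one_iff.2 ?_)) h3
    nlinarith

theorem comp_two_mul (hf : RealPoleBounds f z) : RealPoleBounds (fun s => f (2 * s)) (z / 2) := by
  obtain ⟨k, hk, K, hf⟩ := hf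
  refine ⟨k / 2, by positivity, K / 2, ?_⟩
  have hlim : Tendsto (fun σ : ℝ => 2 * σ) (𝓝[>] (z / 2)) (𝓝[>] z) := by
    refine tendsto_nhdsWithin_iff.2 ⟨?_, ?_⟩
    · have : Continuous fun σ : ℝ => 2 * σ := by fun_prop
      have h := this.tendsto (z / 2)
      rw [mul_div_cancel₀ z two_ne_zero] at h
      exact h.mono_left nhdsWithin_le_nhds
    · filter_upwards [self_mem_nhdsWithin] with σ hσ
      have : z / 2 < σ := hσ
      show z < 2 * σ
      linarith
  filter_upwards [hlim.eventually hf, self_mem_nhdsWithin] with σ ⟨u, h1, h2, h3⟩ hσ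
  have hpos : 0 < σ - z / 2 := sub_pos.2 hσ
  have e : ∀ c : ℝ, c / 2 / (σ - z / 2) = c / (2 * σ - z) := by
    intro c
    rw [div_div]; congr 1; ring
  refine ⟨u, by rw [← h1]; push_cast; rfl, by rwa [e], by rwa [e]⟩

end RealPoleBounds

/-! ### Assembly of the generating function -/

namespace TransferOperator

theorem summable_list {A : Type*} [Fintype A] {F : List A → ℂ}
    (hF : ∀ a, Summable fun w => F (a :: w)) : Summable F := by
  rw [← (sumProdEquivList A).summable_iff]
  refine Summable.sum _ Summable.of_finite (Summable.of_norm ?_)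
  exact (summable_prod_of_nonneg fun _ => norm_nonneg _).2
    ⟨fun a => (hF a).norm, Summable.of_finite⟩

end TransferOperator

namespace MetricGraph

section

open TransferOperator

variable {V E : Type*} {G : MetricGraph V E} {v₀ : V}

open Classical in
/-- The contribution of the pair `(c, w)` to the generating function of a conjugacy class. -/
noncomputable def conjWeight (o : CoverVertex G v₀) (C : ConjClasses (G.fundamentalGroup v₀))
    (s : ℂ) (c w : List (E × Bool)) : ℂ :=
  if (c, w) ∈ conjPairs o C then
    Complex.exp (-s * ((G.pathLength c + 2 * G.pathLength w : ℝ) : ℂ)) else 0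

-- The conjugating path is traversed twice, once in each direction, so its weight is a path weight
-- at 2s.
open Classical in
theorem conjWeight_cons {o : CoverVertex G v₀} {C : ConjClasses (G.fundamentalGroup v₀)}
    (hC : C ≠ ConjClasses.mk 1) {c : List (E × Bool)} (hc : c ∈ conjCores o C) (s : ℂ)
    (a : E × Bool) (w : List (E × Bool)) :
    conjWeight o C s c (a :: w) = if G.initial a = o.1.1 then Complex.exp (-s * G.pathLength c) *
      pathWeight G.Follows G.orientedLength (CanPrecede G c) (2 * s) a w else 0 := by
  rw [conjWeight, pathWeight_eq]
  simp only [cons_mem_conjPairs_iff hC hc]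
  by_cases h1 : G.initial a = o.1.1
  · simp only [h1, true_and, if_true]
    split_ifs with h2
    · rw [← Complex.exp_add]
      congr 1
      have : (((a :: w).map G.orientedLength).sum : ℝ) = G.pathLength (a :: w) := rfl
      rw [this]
      push_cast; ring
    · simp
  · simp [h1]

theorem summable_conjWeight [Fintype E] {o : CoverVertex G v₀}
    {C : ConjClasses (G.fundamentalGroup v₀)} (hC : C ≠ ConjClasses.mk 1) {c : List (E × Bool)}
    (hc : c ∈ conjCores o C) {s : ℂ}
    (hs : ∀ a, Summable fun w =>
      pathWeight G.Follows G.orientedLength (CanPrecede G c) (2 * s) a w) :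
    Summable (conjWeight o C s c) := by
  classical
  refine summable_list fun a => ?_
  simp only [conjWeight_cons hC hc]
  split_ifs
  · exact (hs a).mul_left _
  · exact summable_zero

open Classical in
theorem tsum_conjWeight [Fintype E] {o : CoverVertex G v₀}
    {C : ConjClasses (G.fundamentalGroup v₀)} (hC : C ≠ ConjClasses.mk 1) {c : List (E × Bool)}
    (hc : c ∈ conjCores o C) {s : ℂ}
    (hs : ∀ a, Summable fun w =>
      pathWeight G.Follows G.orientedLength (CanPrecede G c) (2 * s) a w) :
    ∑' w, conjWeight o C s c w = Complex.exp (-s * G.pathLength c) *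
      (((if (c, []) ∈ conjPairs o C then 1 else 0 : ℝ) : ℂ) + ∑ a with G.initial a = o.1.1,
        pathSeries G.Follows G.orientedLength (CanPrecede G c) (2 * s) a) := by
  rw [tsum_list_complex (summable_conjWeight hC hc hs), mul_add, Finset.mul_sum, Finset.sum_filter]
  refine congrArg₂ _ ?_ (Finset.sum_congr rfl fun a _ => ?_)
  · rw [conjWeight]
    split_ifs <;> simp [pathLength]
  · simp only [conjWeight_cons hC hc]
    split_ifs
    · rw [tsum_mul_left]; rfl
    · simp

/-- Core and conjugator inject the class into pairs, and `conjWeight` vanishes off the image, so the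
sum may be taken over all lists for each of the finitely many cores. -/
theorem hasSum_conj [Fintype E] {o : CoverVertex G v₀}
    {C : ConjClasses (G.fundamentalGroup v₀)} (hC : C ≠ ConjClasses.mk 1) {s : ℂ}
    (hs : ∀ Q a, Summable fun w => pathWeight G.Follows G.orientedLength Q (2 * s) a w)
    {R : Finset (List (E × Bool))} (hR : ∀ c, c ∈ R ↔ c ∈ conjCores o C) :
    HasSum (fun x : C.carrier => Complex.exp (-s * (G.displacement v₀ o x : ℂ)))
      (∑ c ∈ R, ∑' w, conjWeight o C s c w) := by
  classical
  have h1 : Summable fun p : R × List (E × Bool) => conjWeight o C s p.1 p.2 := by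
    refine Summable.of_norm ((summable_prod_of_nonneg fun _ => norm_nonneg _).2
      ⟨fun c => ?_, Summable.of_finite⟩)
    exact (summable_conjWeight hC ((hR c).1 c.2) (hs _)).norm
  have h2 : ∑' p : R × List (E × Bool), conjWeight o C s p.1 p.2 =
      ∑ c ∈ R, ∑' w, conjWeight o C s c w := by
    rw [h1.tsum_prod, tsum_fintype, Finset.sum_coe_sort R fun c => ∑' w, conjWeight o C s c w]
  rw [← h2]
  let i : C.carrier → R × List (E × Bool) := fun x =>
    (⟨(conjEquiv o C x).1.1, (hR _).2 ⟨_, (conjEquiv o C x).2⟩⟩, (conjEquiv o C x).1.2)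
  have hi : Function.Injective i := by
    intro x y hxy
    apply (conjEquiv o C).injective
    simp only [i, Prod.mk.injEq, Subtype.mk.injEq] at hxy
    exact Subtype.ext (Prod.ext hxy.1 hxy.2)
  have hsupp : ∀ p ∉ Set.range i, conjWeight o C s p.1 p.2 = 0 := by
    intro p hp
    rw [conjWeight, if_neg]
    intro hmem
    refine hp ⟨(conjEquiv o C).symm ⟨_, hmem⟩, ?_⟩
    simp [i]
  have h3 := (hi.hasSum_iff hsupp).2 h1.hasSum
  convert h3 using 1
  funext x
  simp only [Function.comp_apply, i, conjWeight]
  rw [if_pos (conjEquiv o C x).2, displacement_eq_of_conjEquiv]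

open Classical in
/-- The contribution of the core `c` to the generating function of a conjugacy class. -/
noncomputable def coreTerm [Fintype E] (o : CoverVertex G v₀)
    (C : ConjClasses (G.fundamentalGroup v₀)) (c : List (E × Bool)) (s : ℂ) : ℂ :=
  Complex.exp (-s * G.pathLength c) *
    (((if (c, []) ∈ conjPairs o C then 1 else 0 : ℝ) : ℂ) + ∑ a with G.initial a = o.1.1,
      pathSeries G.Follows G.orientedLength (CanPrecede G c) (2 * s) a)

open Classical in
/-- The product of `coreTerm` and the determinant of the transfer matrix. -/
noncomputable def coreNumerator [Fintype E] (o : CoverVertex G v₀)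
    (C : ConjClasses (G.fundamentalGroup v₀)) (c : List (E × Bool)) (s : ℂ) : ℂ :=
  Complex.exp (-s * G.pathLength c) *
    (((if (c, []) ∈ conjPairs o C then 1 else 0 : ℝ) : ℂ) *
      transferDet G.Follows G.orientedLength (2 * s) +
      ∑ a with G.initial a = o.1.1,
        pathNumerator G.Follows G.orientedLength (CanPrecede G c) (2 * s) a)

theorem differentiable_transferDet_two_mul [Fintype E] (G : MetricGraph V E) : Differentiable ℂ fun s : ℂ =>
    transferDet G.Follows G.orientedLength (2 * s) := by
  have h2 : Differentiable ℂ fun s : ℂ => 2 * s := by fun_prop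
  exact differentiable_transferDet.comp h2

theorem differentiable_coreNumerator [Fintype E] (o : CoverVertex G v₀)
    (C : ConjClasses (G.fundamentalGroup v₀)) (c : List (E × Bool)) :
    Differentiable ℂ (coreNumerator o C c) := by
  classical
  have h2 : Differentiable ℂ fun s : ℂ => 2 * s := by fun_prop
  have hnum : ∀ a, Differentiable ℂ fun s : ℂ =>
      pathNumerator G.Follows G.orientedLength (CanPrecede G c) (2 * s) a := fun a =>
    (differentiable_pathNumerator (N := G.Follows) (l := G.orientedLength)
      (Q := CanPrecede G c) a).comp h2
  refine Differentiable.mul (by fun_prop) ?_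
  exact Differentiable.add ((differentiable_const _).mul (differentiable_transferDet_two_mul G))
    (Differentiable.fun_sum fun a _ => hnum a)

theorem transferDet_mul_coreTerm [Fintype E] (o : CoverVertex G v₀)
    (C : ConjClasses (G.fundamentalGroup v₀)) (c : List (E × Bool)) {s : ℂ}
    (hs : ∀ a, Summable fun w =>
      pathWeight G.Follows G.orientedLength (CanPrecede G c) (2 * s) a w) :
    transferDet G.Follows G.orientedLength (2 * s) * coreTerm o C c s =
      coreNumerator o C c s := by
  simp only [coreTerm, coreNumerator, ← transferDet_mul_pathSeries hs, ← Finset.mul_sum]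
  generalize ∑ a ∈ _, pathSeries _ _ _ _ a = z
  ring

/-- The lower bound needs a Perron function of the reversed relation; it is `v` composed with
orientation reversal. Rescaling by 2 moves the pole from h to h/2. -/
theorem realPoleBounds_coreTerm [Fintype V] [Fintype E] [Nonempty E] (hconn : G.Connected)
    (hdeg : ∀ v, 3 ≤ G.degree v) {h : ℝ} (hh : 0 < h) {v : E × Bool → ℝ} (hv : ∀ a, 0 < v a)
    (hT : ∀ a, transfer G.Follows G.orientedLength h v a = v a)
    (o : CoverVertex G v₀) {C : ConjClasses (G.fundamentalGroup v₀)}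
    (hC : C ≠ ConjClasses.mk 1) {c : List (E × Bool)} (hc : c ∈ conjCores o C) :
    RealPoleBounds (coreTerm o C c) (h / 2) := by
  classical
  refine RealPoleBounds.exp_mul (pathLength_nonneg c) (by positivity) ?_
  refine RealPoleBounds.const_add (by split_ifs <;> norm_num) ?_
  refine RealPoleBounds.sum ?_ fun a _ => ?_
  · have h3 := hdeg o.1.1
    rw [degree_eq_card] at h3
    convert Finset.card_pos.1 (by omega :
      0 < (Finset.univ.filter fun a => G.initial a = o.1.1).card)
  · obtain ⟨k, hk, K, H⟩ := exists_pathSeries_bounds G.orientedLength_pos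
      (reflTransGen_follows hconn hdeg) hh hv hT (fun a => hv (rev a))
      (transfer_flip_follows hT) (exists_canPrecede hdeg hC hc)
    refine RealPoleBounds.comp_two_mul
      (f := fun s => pathSeries G.Follows G.orientedLength (CanPrecede G c) s a)
      ⟨k, hk, K, ?_⟩
    filter_upwards [Ioc_mem_nhdsGT (show h < h + 1 by linarith)] with σ hσ
    exact H σ hσ.1 hσ.2 a

/-- The analytic properties of the generating function of a conjugacy class. -/
theorem conjGenFun_properties [Fintype V] [Fintype E] [Nonempty E] (hconn : G.Connected)
    (hdeg : ∀ v, 3 ≤ G.degree v)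
    (hlen : ¬ ∃ H : AddSubgroup ℝ, DiscreteTopology H ∧ G.closedGeodesicLengths ⊆ (H : Set ℝ))
    {h : ℝ} (hh : 0 < h) {v : E × Bool → ℝ} (hv : ∀ a, 0 < v a)
    (hT : ∀ a, transfer G.Follows G.orientedLength h v a = v a)
    (o : CoverVertex G v₀) {C : ConjClasses (G.fundamentalGroup v₀)}
    (hC : C ≠ ConjClasses.mk 1) :
    (∀ s : ℂ, h / 2 < s.re →
      Summable fun x : C.carrier => Complex.exp (-s * (G.displacement v₀ o x : ℂ))) ∧
    AnalyticOnNhd ℂ (G.conjGenFun v₀ o C) {s : ℂ | h / 2 < s.re} ∧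
    ∃ (c : ℝ) (U : Set ℂ) (f : ℂ → ℂ),
      0 < c ∧ IsOpen U ∧ {s : ℂ | h / 2 ≤ s.re} ⊆ U ∧
      AnalyticOnNhd ℂ f (U \ {((h / 2 : ℝ) : ℂ)}) ∧
      (∀ s : ℂ, h / 2 < s.re → f s = G.conjGenFun v₀ o C s) ∧
      HasSimplePoleAt f ((h / 2 : ℝ) : ℂ) (c : ℂ) := by
  classical
  obtain ⟨R, hR⟩ : ∃ R : Finset (List (E × Bool)), ∀ c, c ∈ R ↔ c ∈ conjCores o C :=
    ⟨(conjCores_finite o C).toFinset, fun c => Set.Finite.mem_toFinset _⟩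
  have hRne : R.Nonempty := by
    obtain ⟨c, hc⟩ := conjCores_nonempty o C
    exact ⟨c, (hR c).2 hc⟩
  have hre : ∀ s : ℂ, (2 * s).re = 2 * s.re := fun s => by simp
  have hsum : ∀ s : ℂ, h / 2 < s.re → ∀ Q a,
      Summable fun w => pathWeight G.Follows G.orientedLength Q (2 * s) a w := fun s hs Q a =>
    summable_pathWeight G.orientedLength_pos hh hv hT (by rw [hre]; linarith) a
  have heta : ∀ s : ℂ, h / 2 < s.re → G.conjGenFun v₀ o C s = ∑ c ∈ R, coreTerm o C c s := by
    intro s hs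
    rw [conjGenFun, (hasSum_conj hC (hsum s hs) hR).tsum_eq]
    exact Finset.sum_congr rfl fun c hc => tsum_conjWeight hC ((hR c).1 hc) (hsum s hs _)
  obtain ⟨k, hk, K, hbounds⟩ := RealPoleBounds.sum hRne fun c hc =>
    realPoleBounds_coreTerm hconn hdeg hh hv hT o hC ((hR c).1 hc)
  refine ⟨fun s hs => (hasSum_conj hC (hsum s hs) hR).summable,
    exists_meromorphic_extension (F := fun s => ∑ c ∈ R, coreNumerator o C c s) (C := K)
      (Differentiable.fun_sum fun c _ => differentiable_coreNumerator o C c)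
      (differentiable_transferDet_two_mul G) (fun s hs hne => ?_) (fun s hs => ?_) hk ?_⟩
  · refine transferDet_ne_zero G.orientedLength_pos
      (reflTransGen_follows hconn hdeg) (no_phase hlen) hv hT (by rw [hre]; linarith) fun e => hne ?_
    push_cast
    rw [← e]; ring
  · rw [heta s hs, Finset.mul_sum]
    exact Finset.sum_congr rfl fun c _ => transferDet_mul_coreTerm o C c (hsum s hs _)
  · filter_upwards [hbounds, self_mem_nhdsWithin] with σ hσ hlt
    rw [heta σ (by simpa using hlt)]
    exact hσ

end

end MetricGraph

theorem mainTheorem3 {V E : Type*} [Finite V] [Finite E] (G : MetricGraph V E)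
    (hconn : G.Connected) (hdeg : ∀ v, 3 ≤ G.degree v)
    (hlen : ¬ ∃ H : AddSubgroup ℝ, DiscreteTopology H ∧ G.closedGeodesicLengths ⊆ (H : Set ℝ))
    (v₀ : V) :
    ∃ h : ℝ, 0 < h ∧
      (∀ o : G.CoverVertex v₀,
        Tendsto (fun T : ℝ => 1 / T * Real.log ((G.universalCover v₀).ballVolume o T))
          atTop (𝓝 h)) ∧
      ∀ (o : G.CoverVertex v₀) (C : ConjClasses (G.fundamentalGroup v₀)),
        C ≠ ConjClasses.mk 1 →
        (∀ s : ℂ, h / 2 < s.re →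
          Summable fun x : C.carrier => Complex.exp (-s * (G.displacement v₀ o x : ℂ))) ∧
        AnalyticOnNhd ℂ (G.conjGenFun v₀ o C) {s : ℂ | h / 2 < s.re} ∧
        ∃ (c : ℝ) (U : Set ℂ) (f : ℂ → ℂ),
          0 < c ∧ IsOpen U ∧ {s : ℂ | h / 2 ≤ s.re} ⊆ U ∧
          AnalyticOnNhd ℂ f (U \ {((h / 2 : ℝ) : ℂ)}) ∧
          (∀ s : ℂ, h / 2 < s.re → f s = G.conjGenFun v₀ o C s) ∧
          HasSimplePoleAt f ((h / 2 : ℝ) : ℂ) (c : ℂ) := by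
  have := Fintype.ofFinite V
  have := Fintype.ofFinite E
  have hE : Nonempty E := by
    have h3 := hdeg v₀
    rw [MetricGraph.degree] at h3
    obtain ⟨a⟩ := (Nat.card_pos_iff.1 (by omega :
      0 < Nat.card {a : E × Bool // G.initial a = v₀})).1
    exact ⟨a.1.1⟩
  obtain ⟨h, hh, v, hv, hT⟩ := TransferOperator.exists_perron G.orientedLength_pos
    (MetricGraph.reflTransGen_follows hconn hdeg) (MetricGraph.exists_follows_pair hdeg)
  exact ⟨h, hh, fun o => MetricGraph.tendsto_log_ballVolume hdeg hh hv hT o,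
    fun o C hC => MetricGraph.conjGenFun_properties hconn hdeg hlen hh hv hT o hC⟩
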